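/- Let $(M,g)$ be a smooth pseudo-Riemannian manifold of signature $(p,q)$, with Levi-Civita connection $\nabla$, and let $v$ be a nowhere-vanishing smooth homothetic gradient field on $M$, i.e. there is a constant $c\in\mathbb R$ with $\nabla_u v=\frac c2 u$ for all tangent vectors $u$. Let $E\subset M$ be a $v$-transverse hypersurface, i.e. a smooth embedded hypersurface to which $v$ is nowhere tangent and such that each maximal integral curve of $v$ meets $E$ in exactly one point. For $x\in M$ and a frame $\mathcal F_x$ at $x$, let $\mathcal F_x^{\gamma}$ be the frame obtained from $\mathcal F_x$ by parallel translation around a smooth closed path $\gamma:[0,1]\to M$ with $\gamma(0)=\gamma(1)=x$, and let $A\cdot\mathcal F_x$ be the image of $\mathcal F_x$ under a linear isometry $A\in \mathrm O(T_xM,g_x)\cong \mathrm O(p,q)$. The holonomy group at $x$ is $$\mathrm{Hol}_x(M,g)=\{A\in \mathrm O(T_xM,g_x) : \text{for any frame } \mathcal F_x \text{ there is a closed path } \gamma \text{ based at } x \text{ with } \mathcal F_x^{\gamma}=A\cdot\mathcal F_x\}.$$ Then for every $x\in E$ $$\mathrm{Hol}_x(M,g)=\{A\in \mathrm O(T_xM,g_x)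 : \text{for any frame } \mathcal F_x \text{ there is a closed path } \gamma\subset E \text{ based at } x \text{ with } \mathcal F_x^{\gamma}=A\cdot\mathcal F_x\},$$ where parallel translation on both sides is that of $(M,g)$. -/

import Mathlib

open Set Bundle
open scoped Manifold ContDiff Topology

noncomputable section

namespace HomotheticHolonomy

/-- The Christoffel symbols of a metric `G` on (an open part of) a vector space `V`: the vector
`Γ` with `G_y (Γ, z) = (1/2) (∂_u G (w, z) + ∂_w G (u, z) - ∂_z G (u, w))` for all `z`, that is,
with components `Γ^k_ij u^i w^j`. -/
def christoffelSymbols {V : Type*} [NormedAddCommGroup V] [NormedSpace ℝ V]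
    (G : V → V →L[ℝ] V →L[ℝ] ℝ) (y u w : V) : V :=
  (G y).inverse ((1 / 2 : ℝ) •
    (fderiv ℝ G y u w + fderiv ℝ G y w u - ((fderiv ℝ G y).flip u).flip w))

variable {n : ℕ} {M : Type*} [TopologicalSpace M] [ChartedSpace (EuclideanSpace ℝ (Fin n)) M]

/-- The model vector space of an `n`-dimensional manifold. -/
abbrev Model (n : ℕ) : Type := EuclideanSpace ℝ (Fin n)

variable (n M) in
/-- A smooth pseudo-Riemannian metric on an `n`-manifold: a smooth section of symmetric
nondegenerate bilinear forms on the tangent spaces, of arbitrary signature. -/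
structure PseudoRiemannianMetric [IsManifold (𝓡 n) ∞ M] where
  val (x : M) : TangentSpace (𝓡 n) x →L[ℝ] TangentSpace (𝓡 n) x →L[ℝ] ℝ
  symm (x : M) (u w : TangentSpace (𝓡 n) x) : val x u w = val x w u
  nondegenerate (x : M) (u : TangentSpace (𝓡 n) x) (hu : ∀ w, val x u w = 0) : u = 0
  contMDiff : ContMDiff (𝓡 n) ((𝓡 n).prod 𝓘(ℝ, Model n →L[ℝ] Model n →L[ℝ] ℝ)) ∞
    (fun x ↦ TotalSpace.mk' (Model n →L[ℝ] Model n →L[ℝ] ℝ) x (val x))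

/-- The differential at `x` of the coordinate map `φ` of the chart around `x₀`. It sends a tangent
vector at `x` to its vector of components in that chart (for `x` in the domain of the chart). -/
def components (x₀ x : M) : TangentSpace (𝓡 n) x →L[ℝ] Model n :=
  mfderiv (𝓡 n) 𝓘(ℝ, Model n) (extChartAt (𝓡 n) x₀) x

/-- The differential at `y` of the inverse `φ⁻¹` of the coordinate map of the chart around `x₀`. -/
def ofComponents (x₀ : M) (y : Model n) :
    Model n →L[ℝ] TangentSpace (𝓡 n) ((extChartAt (𝓡 n) x₀).symm y) :=
  mfderiv 𝓘(ℝ, Model n) (𝓡 n) (extChartAt (𝓡 n) x₀).symm y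

/-- A vector field in the chart around `x₀`: its components as a function of the coordinates. -/
def fieldInChart (v : ∀ x : M, TangentSpace (𝓡 n) x) (x₀ : M) (y : Model n) : Model n :=
  components x₀ ((extChartAt (𝓡 n) x₀).symm y) (v ((extChartAt (𝓡 n) x₀).symm y))

namespace PseudoRiemannianMetric

variable [IsManifold (𝓡 n) ∞ M] (g : PseudoRiemannianMetric n M)

/-- The metric in the chart around `x₀`: the components `g_ij` as a function of the coordinates,
seen as the bilinear form `(u, w) ↦ g_ij(y) u^i w^j`. -/
def inChart (x₀ : M) (y : Model n) : Model n →L[ℝ] Model n →L[ℝ] ℝ :=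
  (ofComponents x₀ y).precomp ℝ ∘L g.val ((extChartAt (𝓡 n) x₀).symm y) ∘L ofComponents x₀ y

/-- The Christoffel symbols `Γ^k_ij u^i w^j` of the Levi-Civita connection of `g` in the chart
around `x₀`, at the point with coordinates `y`. -/
def christoffel (x₀ : M) (y u w : Model n) : Model n :=
  christoffelSymbols (g.inChart x₀) y u w

/-- The Levi-Civita covariant derivative `∇_u v` in the chart around `x₀`, that is,
`u^i (∂_i v^k + Γ^k_ij v^j)` at the point with coordinates `y`. -/
def covDerivInChart (v : ∀ x : M, TangentSpace (𝓡 n) x) (x₀ : M) (y u : Model n) : Model n :=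
  fderiv ℝ (fieldInChart v x₀) y u + g.christoffel x₀ y u (fieldInChart v x₀ y)

/-- `v` is a homothetic gradient field: for some constant `c`, we have `∇_u v = (c / 2) u` for
all tangent vectors `u`. -/
def IsHomotheticGradient (v : ∀ x : M, TangentSpace (𝓡 n) x) : Prop :=
  ∃ c : ℝ, ∀ x₀ : M, ∀ y ∈ (extChartAt (𝓡 n) x₀).target, ∀ u : Model n,
    g.covDerivInChart v x₀ y u = (c / 2) • u

/-- `W` is a parallel vector field along the curve `γ : [0, 1] → M`: `W t` is a tangent vector at
`γ t`, and in every chart `(W^k)' + Γ^k_ij (γ^i)' W^j = 0`. -/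
def IsParallelAlong (γ : ℝ → M) (W : ℝ → TangentBundle (𝓡 n) M) : Prop :=
  (∀ t ∈ Icc (0 : ℝ) 1, (W t).proj = γ t) ∧
  ∀ t ∈ Icc (0 : ℝ) 1, ∀ x₀ : M, γ t ∈ (extChartAt (𝓡 n) x₀).source →
    HasDerivWithinAt (fun s ↦ components x₀ (W s).proj (W s).snd)
      (-g.christoffel x₀ (extChartAt (𝓡 n) x₀ (γ t))
        (derivWithin (fun s ↦ extChartAt (𝓡 n) x₀ (γ s)) (Icc 0 1) t)
        (components x₀ (W t).proj (W t).snd))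
      (Icc 0 1) t

/-- Parallel translation along `γ : [0, 1] → M` takes the tangent vector `w` to `w'`. -/
def Transports (γ : ℝ → M) (w w' : TangentBundle (𝓡 n) M) : Prop :=
  ∃ W : ℝ → TangentBundle (𝓡 n) M, g.IsParallelAlong γ W ∧ W 0 = w ∧ W 1 = w'

end PseudoRiemannianMetric

variable (n) in
/-- `γ` restricts to a smooth closed path `[0, 1] → M` based at `q` with trace in `S`.
Corners are not lost: a piecewise smooth path becomes smooth after a change of parameter that is
flat at the corners, which changes neither its trace nor the parallel translation along it. -/
structure IsLoopIn (S : Set M) (q : M) (γ : ℝ → M) : Prop where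
  smooth : ContMDiffOn 𝓘(ℝ, ℝ) (𝓡 n) ∞ γ (Icc 0 1)
  source : γ 0 = q
  target : γ 1 = q
  mapsTo : MapsTo γ (Icc 0 1) S

/-- The linear isometries `A` of `(T_q M, g_q)` such that every frame `F` at `q` is taken to
`A ⬝ F` by parallel translation with respect to `g` around some closed path based at `q`
with trace in `S`. For `S = M` this is the holonomy group of `g` at `q`. -/
def PseudoRiemannianMetric.holonomyOfLoopsIn [IsManifold (𝓡 n) ∞ M]
    (g : PseudoRiemannianMetric n M) (S : Set M) (q : M) :
    Set (TangentSpace (𝓡 n) q ≃ₗ[ℝ] TangentSpace (𝓡 n) q) :=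
  {A | (∀ u w, g.val q (A u) (A w) = g.val q u w) ∧
    ∀ F : Module.Basis (Fin n) ℝ (TangentSpace (𝓡 n) q), ∃ γ : ℝ → M, IsLoopIn n S q γ ∧
      ∀ i, g.Transports γ ⟨q, F i⟩ ⟨q, A (F i)⟩}

/-- The holonomy group of `g` at `q`. -/
def PseudoRiemannianMetric.holonomy [IsManifold (𝓡 n) ∞ M]
    (g : PseudoRiemannianMetric n M) (q : M) :
    Set (TangentSpace (𝓡 n) q ≃ₗ[ℝ] TangentSpace (𝓡 n) q) :=
  g.holonomyOfLoopsIn univ q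

/-- The trace of the maximal integral curve of `v` through `p`: all points that an integral curve
of `v`, defined on an open interval around `0` and starting at `p`, reaches. -/
def integralCurveTrace (v : ∀ x : M, TangentSpace (𝓡 n) x) (p : M) : Set M :=
  {x | ∃ (γ : ℝ → M) (a b : ℝ), (0 : ℝ) ∈ Ioo a b ∧
    IsMIntegralCurveOn (I := 𝓡 n) γ v (Ioo a b) ∧ γ 0 = p ∧ x ∈ γ '' Ioo a b}

variable (n) in
/-- `f` is a smooth defining function of `S` in the open neighbourhood `U` of `x`, regular
at `x`. Then the tangent space of `S` at `x` is the kernel of `df_x`. -/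
structure IsDefiningFunctionAt (S : Set M) (x : M) (U : Set M) (f : M → ℝ) : Prop where
  isOpen : IsOpen U
  mem : x ∈ U
  smooth : ContMDiffOn (𝓡 n) 𝓘(ℝ, ℝ) ∞ f U
  regular : mfderiv (𝓡 n) 𝓘(ℝ, ℝ) f x ≠ 0
  eq_zero_iff : ∀ z ∈ U, z ∈ S ↔ f z = 0

variable (n) in
/-- `S` is a smooth embedded hypersurface: locally a regular level set of a smooth function. -/
def IsHypersurface (S : Set M) : Prop :=
  ∀ x ∈ S, ∃ (U : Set M) (f : M → ℝ), IsDefiningFunctionAt n S x U f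

/-- The hypersurface `S` is `v`-transverse: `v` is nowhere tangent to `S`, and each maximal integral
curve of `v` meets `S` in exactly one point. -/
structure IsTransverseTo (S : Set M) (v : ∀ x : M, TangentSpace (𝓡 n) x) : Prop where
  not_tangent : ∀ x ∈ S, ∀ (U : Set M) (f : M → ℝ), IsDefiningFunctionAt n S x U f →
    mfderiv (𝓡 n) 𝓘(ℝ, ℝ) f x (v x) ≠ 0
  meets_once : ∀ p : M, ∃! x, x ∈ S ∧ x ∈ integralCurveTrace v p

end HomotheticHolonomy

end

/-!
Let `ρ(p)` be the point where the integral curve of `v` through `p` meets `E`. The flow of `v`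
scales the metric by a constant factor, hence preserves the Levi-Civita connection. Because
`∇_u v = (c/2) u`, parallel transport along a flow line for the time `s` is `e^{-cs/2}` times the
differential of the flow. If the time `s(p)` depends on the point, then `r(p) = flow_{s(p)}(p)` has
the differential `d flow + ds ⊗ v`. The term `ds ⊗ v` enters the equation of parallel fields only
through `Γ(v, ·) = (c/2) id`, which the derivative of the factor `e^{-cs/2}` cancels. So
`T = e^{-cs/2} (dr - ds ⊗ v)` is an isometry that takes fields that are parallel along a curve `γ`
to fields that are parallel along `r ∘ γ`. In the chart of a flow box this is `shift_intertwines`,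
and on the manifold `IsFlowBox.isFlowTransport_shift`; such pairs `(r, T)` are called
`IsFlowTransport` here and can be composed.

Chains of flow boxes along an integral curve, followed by a smooth hitting time of `E`, give near
every point of `M` such a pair with values in `E` (`exists_transport_to_hypersurface`). These local
pairs fit together. The maps agree, since an integral curve meets `E` only once. The isometries
agree as well, although a closed integral curve can be followed several times: the two isometries
have the same form, and linear algebra leaves no freedom (`eq_of_isometry_form`). The result is the
global projection `ρ` with isometries `τ`, both the identity over `E` (`exists_projection`). A loop
`γ` at `q ∈ E` and a field parallel along it are taken by `ρ` and `τ` to the loop `ρ ∘ γ` in `E` and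
a field parallel along it with the same values at both ends, so `γ` and `ρ ∘ γ` have the same
parallel translation.

The definition of parallelism uses the preferred charts only, so it is shown to be independent of
the chart; a smooth local flow, needed for flow boxes, is obtained from the inverse function theorem
in a space of continuous curves.
-/

noncomputable section

namespace HomotheticHolonomy

/-! ### Smooth local flows in a vector space -/

section Analysis

universe u

variable {K : Type*} [TopologicalSpace K] [CompactSpace K]
variable {V W : Type u} [NormedAddCommGroup V] [NormedSpace ℝ V] [NormedAddCommGroup W]
  [NormedSpace ℝ W]

set_option linter.unusedSectionVars false

variable (K V W) in
set_option synthInstance.maxHeartbeats 200000 in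
/-- Pointwise evaluation `(A, h) ↦ (t ↦ A t (h t))` as a continuous bilinear map on spaces of
continuous functions with the supremum norm. -/
def pointwiseApply : C(K, V →L[ℝ] W) →L[ℝ] C(K, V) →L[ℝ] C(K, W) :=
  LinearMap.mkContinuous₂
    (LinearMap.mk₂ ℝ (fun (A : C(K, V →L[ℝ] W)) (h : C(K, V)) ↦
        (⟨fun t ↦ A t (h t), by fun_prop⟩ : C(K, W)))
      (fun A B h ↦ by ext t; simp) (fun a A h ↦ by ext t; simp)
      (fun A h k ↦ by ext t; simp) (fun a A h ↦ by ext t; simp))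
    1 (fun A h ↦ by
      rw [ContinuousMap.norm_le _ (by positivity)]
      intro t
      rw [one_mul]
      exact (A t).le_of_opNorm_le_of_le (A.norm_coe_le_norm t) (h.norm_coe_le_norm t))

lemma continuous_postcomp_of_continuous {f : V → W} (hf : Continuous f) :
    Continuous (fun α : C(K, V) ↦ (⟨fun t ↦ f (α t), hf.comp α.continuous⟩ : C(K, W))) :=
  ContinuousMap.continuous_postcomp ⟨f, hf⟩

set_option synthInstance.maxHeartbeats 200000 in
lemma hasFDerivAt_postcomp {f : V → W} {f' : V → V →L[ℝ] W} (hf' : Continuous f')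
    (h : ∀ x, HasFDerivAt f (f' x) x) (hf : Continuous f) (α : C(K, V)) :
    HasFDerivAt (fun α : C(K, V) ↦ (⟨fun t ↦ f (α t), hf.comp α.continuous⟩ : C(K, W)))
      (pointwiseApply K V W ⟨fun t ↦ f' (α t), hf'.comp α.continuous⟩) α := by
  rw [hasFDerivAt_iff_isLittleO_nhds_zero, Asymptotics.isLittleO_iff]
  intro ε hε
  have hc := (continuous_postcomp_of_continuous (K := K) hf').continuousAt (x := α)
  obtain ⟨δ, hδ, hball⟩ := Metric.continuousAt_iff.1 hc ε hε
  filter_upwards [Metric.ball_mem_nhds (0 : C(K, V)) hδ] with k hk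
  rw [ContinuousMap.norm_le _ (by positivity)]
  intro t
  have hseg : ∀ y ∈ segment ℝ (α t) (α t + k t), ‖f' y - f' (α t)‖ ≤ ε := by
    intro y hy
    rw [segment_eq_image'] at hy
    obtain ⟨τ, hτ, rfl⟩ := hy
    have h1 : dist (α + τ • k) α < δ := by
      rw [dist_eq_norm, add_sub_cancel_left, norm_smul]
      have : ‖k‖ < δ := by simpa using hk
      calc ‖τ‖ * ‖k‖ ≤ 1 * ‖k‖ := by
            gcongr; rw [Real.norm_eq_abs, abs_le]; constructor <;> linarith [hτ.1, hτ.2]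
        _ < δ := by linarith
    have h2 := (ContinuousMap.dist_apply_le_dist t).trans (hball h1).le
    rw [dist_eq_norm] at h2
    simpa using h2
  have := (convex_segment (α t) (α t + k t)).norm_image_sub_le_of_norm_hasFDerivWithin_le'
    (f := f) (f' := f') (φ := f' (α t)) (C := ε)
    (fun y _ ↦ (h y).hasFDerivWithinAt) hseg (left_mem_segment ..) (right_mem_segment ..)
  calc _ = ‖f (α t + k t) - f (α t) - f' (α t) (α t + k t - α t)‖ := by
        simp [pointwiseApply]
    _ ≤ ε * ‖α t + k t - α t‖ := this
    _ ≤ ε * ‖k‖ := by gcongr; simpa using k.norm_coe_le_norm t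

set_option synthInstance.maxHeartbeats 200000 in
/-- Composition with a smooth map is a smooth operator on `C(K, V)`: its derivative at `α` is
multiplication by `f' ∘ α`, so that the claim for `C^(n+1)` reduces to the claim for `C^n`. -/
theorem contDiff_postcomp_nat (n : ℕ) {f : V → W} (h : ContDiff ℝ n f) :
    ContDiff ℝ n (fun α : C(K, V) ↦
      (⟨fun t ↦ f (α t), h.continuous.comp α.continuous⟩ : C(K, W))) := by
  induction n generalizing W with
  | zero =>
    exact contDiff_zero.2 (continuous_postcomp_of_continuous h.continuous)
  | succ n ih =>
    have h' : ContDiff ℝ ((n : ℕ∞ω) + 1) f := by simpa using h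
    obtain ⟨f', hf', hd⟩ := contDiff_succ_iff_hasFDerivAt.1 h'
    have hp : ContDiff ℝ n (pointwiseApply K V W) := ContinuousLinearMap.contDiff _
    have : ContDiff ℝ ((n : ℕ∞ω) + 1) (fun α : C(K, V) ↦
      (⟨fun t ↦ f (α t), h.continuous.comp α.continuous⟩ : C(K, W))) :=
      contDiff_succ_iff_hasFDerivAt.2 ⟨fun α ↦ pointwiseApply K V W
          ⟨fun t ↦ f' (α t), hf'.continuous.comp α.continuous⟩,
        hp.comp (ih hf'), fun α ↦ hasFDerivAt_postcomp hf'.continuous hd h.continuous α⟩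
    simpa using this

theorem contDiff_postcomp {f : V → W} (h : ContDiff ℝ ∞ f) :
    ContDiff ℝ ∞ (fun α : C(K, V) ↦
      (⟨fun t ↦ f (α t), h.continuous.comp α.continuous⟩ : C(K, W))) :=
  contDiff_infty.2 fun n ↦ contDiff_postcomp_nat n (contDiff_infty.1 h n)

/-- The inverse function theorem for `C^∞` maps: the inverse is `C^∞` on a whole neighbourhood
(and not only to each finite order on a neighbourhood depending on the order). -/
theorem exists_smooth_localInverse [CompleteSpace V] {f : V → W} {O : Set V} (hO : IsOpen O)
    (hf : ContDiffOn ℝ ∞ f O) {a : V} (ha : a ∈ O) {f' : V ≃L[ℝ] W}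
    (hf' : HasFDerivAt f (f' : V →L[ℝ] W) a) :
    ∃ e : OpenPartialHomeomorph V W, (∀ x, e x = f x) ∧ a ∈ e.source ∧ e.source ⊆ O ∧
      ContDiffOn ℝ ∞ e.symm e.target := by
  have hfa : ContDiffAt ℝ ∞ f a := hf.contDiffAt (hO.mem_nhds ha)
  set e₀ := hfa.toOpenPartialHomeomorph f hf' (by simp)
  have hcont : ContinuousOn (fderiv ℝ f) O :=
    hf.continuousOn_fderiv_of_isOpen hO (by simp)
  set O' := O ∩ fderiv ℝ f ⁻¹' range ((↑) : (V ≃L[ℝ] W) → V →L[ℝ] W)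
  have hO' : IsOpen O' := hcont.isOpen_inter_preimage hO ContinuousLinearEquiv.isOpen
  have haO' : a ∈ O' := ⟨ha, f', hf'.fderiv.symm⟩
  refine ⟨e₀.restrOpen O' hO', fun x ↦ rfl, ⟨?_, haO'⟩, fun x hx ↦ hx.2.1, ?_⟩
  · exact hfa.mem_toOpenPartialHomeomorph_source hf' (by simp)
  · intro y hy
    have hx := (e₀.restrOpen O' hO').map_target hy
    obtain ⟨⟨hxO, L, hL⟩, -⟩ := And.intro hx.2 trivial
    have hc : ContDiffAt ℝ ∞ f ((e₀.restrOpen O' hO').symm y) := hf.contDiffAt (hO.mem_nhds hxO)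
    refine ((e₀.restrOpen O' hO').contDiffAt_symm (f₀' := L) hy ?_ hc).contDiffWithinAt
    rw [hL]
    exact (hc.differentiableAt (by simp)).hasFDerivAt

end Analysis

section Flow

universe u
variable {V : Type u} [NormedAddCommGroup V] [NormedSpace ℝ V]

set_option linter.unusedSectionVars false

/-- The parameter interval for rescaled trajectories. -/
abbrev SymmInterval : Type := Icc (-1 : ℝ) 1

/-- A continuous function on `[-1, 1]`, extended to `ℝ` by constants. -/
abbrev extend (α : C(SymmInterval, V)) : ℝ → V := IccExtend (by norm_num : (-1 : ℝ) ≤ 1) α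

lemma continuous_extend (α : C(SymmInterval, V)) : Continuous (extend α) :=
  α.continuous.Icc_extend'

variable (V) in
/-- The operator `α ↦ (t ↦ ∫₀ᵗ α)` on `C([-1, 1], V)`. -/
def primitive : C(SymmInterval, V) →L[ℝ] C(SymmInterval, V) :=
  LinearMap.mkContinuous
    { toFun := fun α ↦ ⟨fun t ↦ ∫ τ in (0 : ℝ)..t, extend α τ,
        (intervalIntegral.continuous_primitive
          (fun a b ↦ (continuous_extend α).intervalIntegrable a b) 0).comp continuous_subtype_val⟩
      map_add' := fun α β ↦ by
        ext t
        simp only [ContinuousMap.coe_mk, ContinuousMap.add_apply]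
        rw [← intervalIntegral.integral_add ((continuous_extend α).intervalIntegrable _ _)
          ((continuous_extend β).intervalIntegrable _ _)]
        rfl
      map_smul' := fun a α ↦ by
        ext t
        simp only [ContinuousMap.coe_mk, ContinuousMap.smul_apply, RingHom.id_apply]
        rw [← intervalIntegral.integral_smul]
        rfl } 1 (fun α ↦ by
      rw [ContinuousMap.norm_le _ (by positivity)]
      intro t
      have h := intervalIntegral.norm_integral_le_of_norm_le_const (a := (0 : ℝ)) (b := t)
        (f := extend α) (C := ‖α‖) (fun x _ ↦ α.norm_coe_le_norm _)
      refine h.trans ?_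
      have : |(t : ℝ) - 0| ≤ 1 := by rw [sub_zero, abs_le]; exact t.2
      nlinarith [norm_nonneg α])

/-- The trajectory of a point `x` under `s • w`, followed over the time interval `[-1, 1]`, is the
zero `α` of `α - x - s ∫ w ∘ α`. This is the map `(x, s, α) ↦ (x, s, α - x - s ∫ w ∘ α)`. -/
def trajectoryMap (w : V → V) (hw : Continuous w) (p : V × ℝ × C(SymmInterval, V)) :
    V × ℝ × C(SymmInterval, V) :=
  (p.1, p.2.1, p.2.2 - ContinuousMap.const _ p.1 -
    p.2.1 • primitive V ⟨fun t ↦ w (p.2.2 t), hw.comp p.2.2.continuous⟩)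

variable (V) in
/-- The constant functions, as a continuous linear map. -/
def constL : V →L[ℝ] C(SymmInterval, V) :=
  LinearMap.mkContinuous
    { toFun := fun x ↦ ContinuousMap.const _ x
      map_add' := fun _ _ ↦ rfl
      map_smul' := fun _ _ ↦ rfl } 1 (fun x ↦ by
      rw [ContinuousMap.norm_le _ (by positivity)]
      intro t
      rw [one_mul]
      exact le_rfl)

lemma contDiff_trajectoryMap {w : V → V} (hw : ContDiff ℝ ∞ w) :
    ContDiff ℝ ∞ (trajectoryMap w hw.continuous) := by
  have h1 : ContDiff ℝ ∞ (fun p : V × ℝ × C(SymmInterval, V) ↦ constL V p.1) :=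
    (constL V).contDiff.comp contDiff_fst
  have h2 : ContDiff ℝ ∞ (fun p : V × ℝ × C(SymmInterval, V) ↦
      primitive V ⟨fun t ↦ w (p.2.2 t), hw.continuous.comp p.2.2.continuous⟩) :=
    (primitive V).contDiff.comp ((contDiff_postcomp hw).comp (contDiff_snd.comp contDiff_snd))
  have h3 : ContDiff ℝ ∞ (fun p : V × ℝ × C(SymmInterval, V) ↦ p.2.1) :=
    contDiff_fst.comp contDiff_snd
  have h4 : ContDiff ℝ ∞ (fun p : V × ℝ × C(SymmInterval, V) ↦ p.2.2) :=
    contDiff_snd.comp contDiff_snd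
  exact contDiff_fst.prodMk (h3.prodMk ((h4.sub h1).sub (h3.smul h2)))

/-- The derivative of `trajectoryMap` at a point with `s = 0`, where `b = ∫ w ∘ α`. -/
def trajectoryDeriv (b : C(SymmInterval, V)) :
    (V × ℝ × C(SymmInterval, V)) ≃L[ℝ] (V × ℝ × C(SymmInterval, V)) :=
  ContinuousLinearEquiv.equivOfInverse
    ((ContinuousLinearMap.fst ℝ _ _).prod
      (((ContinuousLinearMap.fst ℝ _ _) ∘L (ContinuousLinearMap.snd ℝ _ _)).prod
        (((ContinuousLinearMap.snd ℝ _ _) ∘L (ContinuousLinearMap.snd ℝ _ _)) -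
          constL V ∘L (ContinuousLinearMap.fst ℝ _ _) -
          ((ContinuousLinearMap.fst ℝ _ _) ∘L (ContinuousLinearMap.snd ℝ _ _)).smulRight b)))
    ((ContinuousLinearMap.fst ℝ _ _).prod
      (((ContinuousLinearMap.fst ℝ _ _) ∘L (ContinuousLinearMap.snd ℝ _ _)).prod
        (((ContinuousLinearMap.snd ℝ _ _) ∘L (ContinuousLinearMap.snd ℝ _ _)) +
          constL V ∘L (ContinuousLinearMap.fst ℝ _ _) +
          ((ContinuousLinearMap.fst ℝ _ _) ∘L (ContinuousLinearMap.snd ℝ _ _)).smulRight b)))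
    (fun p ↦ by ext <;> simp; abel) (fun p ↦ by ext <;> simp; abel)

lemma hasFDerivAt_trajectoryMap {w : V → V} (hw : ContDiff ℝ ∞ w) (x : V) (α : C(SymmInterval, V)) :
    HasFDerivAt (trajectoryMap w hw.continuous)
      (trajectoryDeriv (primitive V ⟨fun t ↦ w (α t), hw.continuous.comp α.continuous⟩) :
        (V × ℝ × C(SymmInterval, V)) →L[ℝ] (V × ℝ × C(SymmInterval, V))) (x, 0, α) := by
  set b : V × ℝ × C(SymmInterval, V) → C(SymmInterval, V) := fun p ↦
      primitive V ⟨fun t ↦ w (p.2.2 t), hw.continuous.comp p.2.2.continuous⟩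
  have h2 : ContDiff ℝ ∞ b :=
    (primitive V).contDiff.comp ((contDiff_postcomp hw).comp (contDiff_snd.comp contDiff_snd))
  have hb : HasFDerivAt b (fderiv ℝ b (x, 0, α)) (x, 0, α) :=
    (h2.differentiable (by simp) _).hasFDerivAt
  have h1 : HasFDerivAt (fun p : V × ℝ × C(SymmInterval, V) ↦ constL V p.1)
      (constL V ∘L ContinuousLinearMap.fst ℝ _ _) (x, 0, α) :=
    (constL V).hasFDerivAt.comp _ hasFDerivAt_fst
  have h3 : HasFDerivAt (fun p : V × ℝ × C(SymmInterval, V) ↦ p.2.1)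
      ((ContinuousLinearMap.fst ℝ _ _) ∘L (ContinuousLinearMap.snd ℝ _ _)) (x, 0, α) :=
    hasFDerivAt_fst.comp _ hasFDerivAt_snd
  have h4 : HasFDerivAt (fun p : V × ℝ × C(SymmInterval, V) ↦ p.2.2)
      ((ContinuousLinearMap.snd ℝ _ _) ∘L (ContinuousLinearMap.snd ℝ _ _)) (x, 0, α) :=
    hasFDerivAt_snd.comp _ hasFDerivAt_snd
  have := (ContinuousLinearMap.fst ℝ V (ℝ × C(SymmInterval, V))).hasFDerivAt (x := (x, 0, α))
    |>.prodMk
    (h3.prodMk ((h4.sub h1).sub (h3.smul hb)))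
  refine (show HasFDerivAt (trajectoryMap w hw.continuous) _ (x, 0, α) from this).congr_fderiv ?_
  refine ContinuousLinearMap.ext fun p ↦ ?_
  simp [trajectoryDeriv, b]

/-- Existence and smoothness of the local flow of a smooth vector field. The inverse function
theorem for `trajectoryMap`, at the constant trajectory of `x₀` with `s = 0`, gives for `(x, s)`
near `(x₀, 0)` a trajectory over `[-1, 1]` of `x` under `s • w`, which depends smoothly on `(x, s)`;
its value at the time `1` is the flow for the time `s`. -/
theorem exists_smooth_flow [CompleteSpace V] {w : V → V} (hw : ContDiff ℝ ∞ w) (x₀ : V) :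
    ∃ (φ : V × ℝ → V) (N : Set (V × ℝ)), IsOpen N ∧ (x₀, 0) ∈ N ∧ ContDiffOn ℝ ∞ φ N ∧
      (∀ p ∈ N, HasDerivAt (fun s ↦ φ (p.1, s)) (w (φ p)) p.2) ∧
      ∀ x, (x, 0) ∈ N → φ (x, 0) = x := by
  set F := trajectoryMap w hw.continuous
  set a : V × ℝ × C(SymmInterval, V) := (x₀, 0, ContinuousMap.const _ x₀)
  obtain ⟨e, he, hea, -, hes⟩ := exists_smooth_localInverse isOpen_univ
    (contDiff_trajectoryMap hw).contDiffOn (mem_univ a)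
    (hasFDerivAt_trajectoryMap hw x₀ (ContinuousMap.const _ x₀))
  obtain ⟨r, hr, hrs⟩ := Metric.isOpen_iff.1 e.open_source a hea
  have hFa : F a = (x₀, 0, 0) := by
    simp [F, a, trajectoryMap]
  set ι : V × ℝ → V × ℝ × C(SymmInterval, V) := fun p ↦ (p.1, p.2, 0)
  have hι : ContDiff ℝ ∞ ι := contDiff_fst.prodMk (contDiff_snd.prodMk contDiff_const)
  have ha' : ι (x₀, 0) = e a := by rw [he]; exact hFa.symm
  have hopen : IsOpen (ι ⁻¹' (e.target ∩ e.symm ⁻¹' Metric.ball a r)) :=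
    (e.isOpen_inter_preimage_symm Metric.isOpen_ball).preimage hι.continuous
  have hmem : (x₀, (0 : ℝ)) ∈ ι ⁻¹' (e.target ∩ e.symm ⁻¹' Metric.ball a r) := by
    rw [mem_preimage, ha']
    refine ⟨e.map_source hea, ?_⟩
    rw [mem_preimage, e.left_inv hea]
    exact Metric.mem_ball_self hr
  obtain ⟨δ, hδ, hδs⟩ := Metric.isOpen_iff.1 hopen _ hmem
  set α : V × ℝ → C(SymmInterval, V) := fun p ↦ (e.symm (ι p)).2.2
  have one_mem : (1 : ℝ) ∈ Icc (-1 : ℝ) 1 := by norm_num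
  have hsymm : ∀ p ∈ Metric.ball (x₀, (0 : ℝ)) δ, e.symm (ι p) = (p.1, p.2, α p) ∧
      α p = ContinuousMap.const _ p.1 +
        p.2 • primitive V ⟨fun t ↦ w (α p t), hw.continuous.comp (α p).continuous⟩ := by
    intro p hp
    have h1 := e.right_inv (hδs hp).1
    rw [he] at h1
    have h1a : (e.symm (ι p)).1 = p.1 := congrArg (fun z ↦ z.1) h1
    have h1b : (e.symm (ι p)).2.1 = p.2 := congrArg (fun z ↦ z.2.1) h1
    have h1c := congrArg (fun z ↦ z.2.2) h1
    simp only [trajectoryMap, h1a, h1b, ι] at h1c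
    refine ⟨Prod.ext h1a (Prod.ext h1b rfl), ?_⟩
    rw [sub_sub, sub_eq_zero] at h1c
    exact h1c
  -- Rescaling the trajectory for `s` gives the trajectory for `t * s`.
  have hscale : ∀ x s, (x, s) ∈ Metric.ball (x₀, (0 : ℝ)) δ → ∀ t : SymmInterval,
      α (x, t * s) ⟨1, one_mem⟩ = α (x, s) t := by
    intro x s hp t
    set A := α (x, s) with hA
    obtain ⟨h1, h2⟩ := hsymm _ hp
    have hval : ∀ τ : SymmInterval, A τ = x + s • ∫ σ in (0 : ℝ)..τ, w (extend A σ) := fun τ ↦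
      congrArg (fun f : C(SymmInterval, V) ↦ f τ) h2
    set B : C(SymmInterval, V) := ⟨fun τ ↦ extend A (t * τ),
      (continuous_extend A).comp (by fun_prop)⟩
    have htτ : ∀ τ : SymmInterval, (t : ℝ) * τ ∈ Icc (-1 : ℝ) 1 := by
      intro τ
      rw [mem_Icc, ← abs_le, abs_mul]
      exact mul_le_one₀ (abs_le.2 t.2) (abs_nonneg _) (abs_le.2 τ.2)
    have hB : ∀ τ : SymmInterval, B τ = A ⟨t * τ, htτ τ⟩ := fun τ ↦
      IccExtend_of_mem _ _ (htτ τ)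
    have hBball : (x, t * s, B) ∈ Metric.ball a r := by
      have h3 := (hδs hp).2
      rw [mem_preimage, h1] at h3
      simp only [a, Metric.mem_ball, Prod.dist_eq, max_lt_iff] at h3 ⊢
      refine ⟨h3.1, lt_of_le_of_lt ?_ h3.2.1, lt_of_le_of_lt ?_ h3.2.2⟩
      · rw [Real.dist_eq, Real.dist_eq, sub_zero, sub_zero, abs_mul]
        exact mul_le_of_le_one_left (abs_nonneg _) (abs_le.2 t.2)
      · rw [ContinuousMap.dist_le dist_nonneg]
        intro τ
        rw [hB]
        exact ContinuousMap.dist_apply_le_dist (f := A) (g := ContinuousMap.const _ x₀)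
          ⟨t * τ, htτ τ⟩
    have hFB : F (x, t * s, B) = ι (x, t * s) := by
      refine Prod.ext rfl (Prod.ext rfl ?_)
      ext τ
      have h4 : ∫ σ in (0 : ℝ)..τ, w (extend B σ) = ∫ σ in (0 : ℝ)..τ, w (extend A (t * σ)) := by
        refine intervalIntegral.integral_congr fun σ hσ ↦ ?_
        have : σ ∈ Icc (-1 : ℝ) 1 :=
          (uIcc_subset_Icc (by norm_num : (0 : ℝ) ∈ Icc (-1 : ℝ) 1) τ.2) hσ
        change w (extend B σ) = _
        rw [show extend B σ = B ⟨σ, this⟩ from IccExtend_of_mem _ _ this]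
        rfl
      have h5 := intervalIntegral.smul_integral_comp_mul_left (a := (0 : ℝ)) (b := τ)
        (fun σ ↦ w (extend A σ)) (t : ℝ)
      change B τ - x - (t * s) • (∫ σ in (0 : ℝ)..τ, w (extend B σ)) = 0
      rw [hB, hval, h4, mul_comm (t : ℝ) s, mul_smul, h5, mul_zero]
      abel
    have h6 := e.left_inv (hrs hBball)
    rw [he, show trajectoryMap w hw.continuous = F from rfl, hFB] at h6
    change (e.symm (ι (x, t * s))).2.2 ⟨1, one_mem⟩ = A t
    rw [h6]
    change B _ = _
    rw [hB]
    congr 1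
    exact Subtype.ext (mul_one _)
  refine ⟨fun p ↦ α p ⟨1, one_mem⟩, Metric.ball (x₀, 0) δ, Metric.isOpen_ball,
    Metric.mem_ball_self hδ, ?_, ?_, ?_⟩
  · have h1 : ContDiffOn ℝ ∞ (fun p ↦ e.symm (ι p)) (Metric.ball (x₀, (0 : ℝ)) δ) :=
      hes.comp hι.contDiffOn fun p hp ↦ (hδs hp).1
    exact ((ContinuousMap.evalCLM ℝ (⟨1, one_mem⟩ : SymmInterval)).contDiff.comp
      (contDiff_snd.comp contDiff_snd)).comp_contDiffOn h1
  · rintro ⟨x, s₀⟩ hp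
    obtain ⟨hx, hs⟩ : dist x x₀ < δ ∧ |s₀| < δ := by
      simpa [Prod.dist_eq, Real.dist_eq] using hp
    obtain ⟨s₁, hs₁, hs₁'⟩ := exists_between hs
    have hs₁0 : 0 < s₁ := (abs_nonneg _).trans_lt hs₁
    have hp₁ : (x, s₁) ∈ Metric.ball (x₀, (0 : ℝ)) δ := by
      simp [Prod.dist_eq, hx, abs_of_pos hs₁0, hs₁']
    set A := α (x, s₁)
    have hval : ∀ τ : SymmInterval, A τ = x + s₁ • ∫ σ in (0 : ℝ)..τ, w (extend A σ) := fun τ ↦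
      congrArg (fun f : C(SymmInterval, V) ↦ f τ) (hsymm _ hp₁).2
    have hφ : ∀ s, |s| < s₁ → α (x, s) ⟨1, one_mem⟩ =
        x + s₁ • ∫ σ in (0 : ℝ)..s / s₁, w (extend A σ) := by
      intro s hs
      have hm : s / s₁ ∈ Icc (-1 : ℝ) 1 := by
        rw [mem_Icc, ← abs_le, abs_div, abs_of_pos hs₁0]
        exact (div_le_one hs₁0).2 hs.le
      have := hscale x s₁ hp₁ ⟨s / s₁, hm⟩
      rw [show ((⟨s / s₁, hm⟩ : SymmInterval) : ℝ) * s₁ = s from div_mul_cancel₀ _ hs₁0.ne'] at this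
      rw [this]
      exact hval _
    have hev : (fun s ↦ α (x, s) ⟨1, one_mem⟩) =ᶠ[𝓝 s₀]
        fun s ↦ x + s₁ • ∫ σ in (0 : ℝ)..s / s₁, w (extend A σ) := by
      filter_upwards [(isOpen_lt continuous_abs continuous_const).mem_nhds hs₁] with s hs
      exact hφ s hs
    refine HasDerivAt.congr_of_eventuallyEq ?_ hev
    have hm : s₀ / s₁ ∈ Icc (-1 : ℝ) 1 := by
      rw [mem_Icc, ← abs_le, abs_div, abs_of_pos hs₁0]
      exact (div_le_one hs₁0).2 hs₁.le
    have hAs : extend A (s₀ / s₁) = α (x, s₀) ⟨1, one_mem⟩ := by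
      rw [hφ s₀ hs₁, show extend A (s₀ / s₁) = A ⟨_, hm⟩ from IccExtend_of_mem _ _ hm, hval]
    have hc : Continuous fun σ ↦ w (extend A σ) := hw.continuous.comp (continuous_extend A)
    have h7 : HasDerivAt (fun u ↦ ∫ σ in (0 : ℝ)..u, w (extend A σ)) (w (extend A (s₀ / s₁)))
        (s₀ / s₁) :=
      intervalIntegral.integral_hasDerivAt_right (hc.intervalIntegrable _ _)
        (hc.stronglyMeasurableAtFilter _ _) hc.continuousAt
    have h8 := ((h7.scomp s₀ ((hasDerivAt_id s₀).div_const s₁)).const_smul s₁).const_add x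
    rw [smul_smul, mul_one_div_cancel hs₁0.ne', one_smul, hAs] at h8
    exact h8
  · intro x hx
    have := congrArg (fun f : C(SymmInterval, V) ↦ f ⟨1, one_mem⟩) (hsymm _ hx).2
    simpa using this

end Flow

/-! ### Straightening and hitting times -/

section FlowBox

variable {V : Type*} [NormedAddCommGroup V] [NormedSpace ℝ V] [FiniteDimensional ℝ V]

/-- Straightening of a nonvanishing vector field `w`: there are coordinates on a ball in which `w`
is the constant field `w y₀`. -/
theorem exists_straightening {O : Set V} (hO : IsOpen O) {w : V → V} (hw : ContDiffOn ℝ ∞ w O)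
    {y₀ : V} (hy₀ : y₀ ∈ O) (hne : w y₀ ≠ 0) :
    ∃ (r : ℝ) (Ψ : OpenPartialHomeomorph V V), 0 < r ∧ Ψ.source = Metric.ball 0 r ∧ Ψ 0 = y₀ ∧
      Ψ.target ⊆ O ∧ ContDiffOn ℝ ∞ Ψ Ψ.source ∧ ContDiffOn ℝ ∞ Ψ.symm Ψ.target ∧
      ∀ y ∈ Ψ.source, fderiv ℝ Ψ y (w y₀) = w (Ψ y) := by
  have : CompleteSpace V := FiniteDimensional.complete ℝ V
  set v₀ := w y₀
  -- A cut-off makes the field globally smooth.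
  obtain ⟨R, hR, hRO⟩ := Metric.nhds_basis_closedBall.mem_iff.1 (hO.mem_nhds hy₀)
  let χ : ContDiffBump y₀ := ⟨R / 2, R, by positivity, by linarith⟩
  have hw' : ContDiff ℝ ∞ (fun y ↦ χ y • w y) := by
    refine contDiff_iff_contDiffAt.2 fun y ↦ ?_
    by_cases hy : y ∈ tsupport χ
    swap
    · refine (contDiffAt_const (c := (0 : V))).congr_of_eventuallyEq ?_
      filter_upwards [(isClosed_tsupport _).isOpen_compl.mem_nhds hy] with z hz
      rw [image_eq_zero_of_notMem_tsupport hz, zero_smul]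
    have hyO : y ∈ O := hRO (χ.tsupport_eq ▸ hy)
    exact χ.contDiff.contDiffAt.smul (hw.contDiffAt (hO.mem_nhds hyO))
  have hww : ∀ y ∈ Metric.ball y₀ (R / 2), χ y • w y = w y := fun y hy ↦ by
    rw [χ.one_of_mem_closedBall (Metric.ball_subset_closedBall hy), one_smul]
  obtain ⟨φ, N, hN, hmem, hφ, hφd, hφ0⟩ := exists_smooth_flow hw' y₀
  obtain ⟨ℓ, hℓ⟩ := SeparatingDual.exists_eq_one (R := ℝ) hne
  -- The flow for the time `ℓ y`, starting from the hyperplane `y₀ + ker ℓ`, gives the coordinates.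
  set j : V → V × ℝ := fun y ↦ (y₀ + y - ℓ y • v₀, ℓ y)
  have hj : ContDiff ℝ ∞ j :=
    ((contDiff_const.add contDiff_id).sub (ℓ.contDiff.smul contDiff_const)).prodMk ℓ.contDiff
  have hj0 : j 0 = (y₀, 0) := by simp [j]
  set Ψ₀ : V → V := fun y ↦ φ (j y)
  have hΨ₀ : ContDiffOn ℝ ∞ Ψ₀ (j ⁻¹' N) := hφ.comp hj.contDiffOn fun _ h ↦ h
  have hjN : IsOpen (j ⁻¹' N) := hN.preimage hj.continuous
  have h0N : (0 : V) ∈ j ⁻¹' N := by rw [mem_preimage, hj0]; exact hmem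
  set O' := j ⁻¹' N ∩ Ψ₀ ⁻¹' Metric.ball y₀ (R / 2)
  have hO' : IsOpen O' := hΨ₀.continuousOn.isOpen_inter_preimage hjN Metric.isOpen_ball
  have hΨ₀0 : Ψ₀ 0 = y₀ := by simp only [Ψ₀, hj0]; exact hφ0 _ hmem
  have h0 : (0 : V) ∈ O' := ⟨h0N, by
    rw [mem_preimage, hΨ₀0]; exact Metric.mem_ball_self (by positivity)⟩
  have hfd : ∀ y ∈ j ⁻¹' N, HasFDerivAt Ψ₀ (fderiv ℝ Ψ₀ y) y := fun y hy ↦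
    ((hΨ₀.contDiffAt (hjN.mem_nhds hy)).differentiableAt (by simp)).hasFDerivAt
  have hline : ∀ y k : V, HasDerivAt (fun s : ℝ ↦ y + s • k) k 0 := fun y k ↦ by
    simpa using ((hasDerivAt_id (0 : ℝ)).smul_const k).const_add y
  have hstraight : ∀ y ∈ O', fderiv ℝ Ψ₀ y v₀ = w (Ψ₀ y) := by
    intro y hy
    have h1 : HasDerivAt (fun s : ℝ ↦ Ψ₀ (y + s • v₀)) (fderiv ℝ Ψ₀ y v₀) 0 := by
      have : HasFDerivAt Ψ₀ (fderiv ℝ Ψ₀ y) (y + (0 : ℝ) • v₀) := by simpa using hfd y hy.1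
      exact this.comp_hasDerivAt (0 : ℝ) (hline y v₀)
    have h2 : (fun s : ℝ ↦ Ψ₀ (y + s • v₀)) = fun s ↦ φ ((j y).1, ℓ y + s) := by
      funext s
      simp only [Ψ₀, j, map_add, map_smul, smul_eq_mul]
      rw [hℓ, mul_one, add_smul]
      congr 2
      abel
    have h3 := (hφd (j y) hy.1)
    have h4 : HasDerivAt (fun s : ℝ ↦ φ ((j y).1, ℓ y + s)) (χ (Ψ₀ y) • w (Ψ₀ y)) 0 := by
      have h5 : HasDerivAt (fun s ↦ φ ((j y).1, s)) (χ (Ψ₀ y) • w (Ψ₀ y)) (ℓ y + 0) := by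
        simpa using h3
      exact h5.comp_const_add (ℓ y) 0
    rw [hww _ hy.2] at h4
    exact (h2 ▸ h1).unique h4
  have hid : HasFDerivAt Ψ₀ ((ContinuousLinearEquiv.refl ℝ V : V ≃L[ℝ] V) : V →L[ℝ] V) 0 := by
    convert hfd 0 h0N using 1
    ext u
    have hk : ∀ k, ℓ k = 0 → fderiv ℝ Ψ₀ 0 k = k := by
      intro k hk
      have h1 : HasDerivAt (fun s : ℝ ↦ Ψ₀ (0 + s • k)) (fderiv ℝ Ψ₀ 0 k) 0 := by
        have : HasFDerivAt Ψ₀ (fderiv ℝ Ψ₀ 0) (0 + (0 : ℝ) • k) := by simpa using hfd 0 h0N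
        exact this.comp_hasDerivAt (0 : ℝ) (hline 0 k)
      have h2 : (fun s : ℝ ↦ Ψ₀ (0 + s • k)) =ᶠ[𝓝 0] fun s ↦ y₀ + s • k := by
        have hc : Continuous (fun s : ℝ ↦ (0 : V) + s • k) := by fun_prop
        have : (fun s : ℝ ↦ (0 : V) + s • k) ⁻¹' (j ⁻¹' N) ∈ 𝓝 (0 : ℝ) :=
          (hjN.preimage hc).mem_nhds (by simpa using h0N)
        filter_upwards [this] with s hs
        have hjs : j (0 + s • k) = (y₀ + s • k, 0) := by simp [j, hk]
        rw [mem_preimage, mem_preimage, hjs] at hs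
        simp only [Ψ₀, hjs]
        exact hφ0 _ hs
      exact h1.unique ((hline y₀ k).congr_of_eventuallyEq h2)
    have h1 := hk (u - ℓ u • v₀) (by simp [hℓ])
    have h2 := hstraight 0 h0
    rw [hΨ₀0] at h2
    rw [map_sub, map_smul, h2] at h1
    exact (sub_left_injective h1).symm
  obtain ⟨e, he, h0e, heO, hes⟩ :=
    exists_smooth_localInverse hO' (hΨ₀.mono inter_subset_left) h0 hid
  obtain ⟨r, hr, hre⟩ := Metric.isOpen_iff.1 e.open_source 0 h0e
  have he' : (e : V → V) = Ψ₀ := funext he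
  have hsrc : (e.restrOpen _ (Metric.isOpen_ball (x := (0 : V)) (ε := r))).source =
      Metric.ball 0 r := by
    rw [e.restrOpen_source, inter_eq_right]; exact hre
  refine ⟨r, e.restrOpen _ (Metric.isOpen_ball (x := (0 : V)) (ε := r)), hr, hsrc,
    ?_, ?_, ?_, ?_, ?_⟩
  · exact (he 0).trans hΨ₀0
  · intro z hz
    have h1 := e.map_target hz.1
    have h2 := (heO h1).2
    rw [mem_preimage, ← he, e.right_inv hz.1] at h2
    exact hRO (Metric.closedBall_subset_closedBall (by linarith) (Metric.ball_subset_closedBall h2))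
  · change ContDiffOn ℝ ∞ (e : V → V) _
    rw [hsrc, he']
    exact hΨ₀.mono fun y hy ↦ (heO (hre hy)).1
  · exact hes.mono fun z hz ↦ hz.1
  · intro y hy
    change fderiv ℝ (e : V → V) y v₀ = w (e y)
    rw [he']
    exact hstraight y (heO (hre (hsrc ▸ hy)))

/-- The lines in a direction `v₀` transverse to the zero set of `h` hit this set after a time that
depends smoothly on the starting point. -/
theorem exists_smooth_hitting_time {O : Set V} (hO : IsOpen O) {h : V → ℝ}
    (hh : ContDiffOn ℝ ∞ h O) {y₀ v₀ : V} (hy₀ : y₀ ∈ O) (h0 : h y₀ = 0)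
    (hv₀ : fderiv ℝ h y₀ v₀ ≠ 0) :
    ∃ (O' : Set V) (σ : V → ℝ), IsOpen O' ∧ y₀ ∈ O' ∧ ContDiffOn ℝ ∞ σ O' ∧ σ y₀ = 0 ∧
      ∀ y ∈ O', y + σ y • v₀ ∈ O ∧ h (y + σ y • v₀) = 0 := by
  have : CompleteSpace V := FiniteDimensional.complete ℝ V
  set m : V × ℝ → V := fun p ↦ p.1 + p.2 • v₀
  have hm : ContDiff ℝ ∞ m := contDiff_fst.add (contDiff_snd.smul contDiff_const)
  have hm' : HasFDerivAt m (ContinuousLinearMap.fst ℝ V ℝ +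
      (ContinuousLinearMap.snd ℝ V ℝ).smulRight v₀) (y₀, 0) :=
    hasFDerivAt_fst.add (hasFDerivAt_snd.smul_const v₀)
  have hm0 : m (y₀, 0) = y₀ := by simp [m]
  set h' := fderiv ℝ h y₀
  have hd : HasFDerivAt h h' (m (y₀, 0)) := by
    rw [hm0]
    exact ((hh.contDiffAt (hO.mem_nhds hy₀)).differentiableAt (by simp)).hasFDerivAt
  let L : (V × ℝ) ≃L[ℝ] (V × ℝ) := ContinuousLinearEquiv.equivOfInverse
    ((ContinuousLinearMap.fst ℝ V ℝ).prod (h' ∘L (ContinuousLinearMap.fst ℝ V ℝ +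
      (ContinuousLinearMap.snd ℝ V ℝ).smulRight v₀)))
    ((ContinuousLinearMap.fst ℝ V ℝ).prod
      ((h' v₀)⁻¹ • (ContinuousLinearMap.snd ℝ V ℝ - h' ∘L ContinuousLinearMap.fst ℝ V ℝ)))
    (fun p ↦ by ext <;> simp; field_simp) (fun p ↦ by ext <;> simp; field_simp; ring)
  have hΦ : HasFDerivAt (fun p : V × ℝ ↦ (p.1, h (m p))) (L : (V × ℝ) →L[ℝ] (V × ℝ)) (y₀, 0) :=
    hasFDerivAt_fst.prodMk (hd.comp _ hm')
  obtain ⟨e, he, hmem, hsub, hes⟩ := exists_smooth_localInverse (hO.preimage hm.continuous)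
    (contDiffOn_fst.prodMk (hh.comp hm.contDiffOn fun _ h ↦ h))
    (show (y₀, (0 : ℝ)) ∈ m ⁻¹' O by rw [mem_preimage, hm0]; exact hy₀) hΦ
  have hι : ContDiff ℝ ∞ (fun y : V ↦ (y, (0 : ℝ))) := contDiff_id.prodMk contDiff_const
  have he0 : e (y₀, 0) = (y₀, 0) := by
    rw [he]
    exact Prod.ext rfl (by change h (m (y₀, 0)) = 0; rw [hm0, h0])
  refine ⟨(fun y ↦ (y, (0 : ℝ))) ⁻¹' e.target, fun y ↦ (e.symm (y, 0)).2,
    e.open_target.preimage hι.continuous, ?_, ?_, ?_, ?_⟩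
  · rw [mem_preimage, ← he0]; exact e.map_source hmem
  · exact contDiff_snd.comp_contDiffOn (hes.comp hι.contDiffOn fun _ h ↦ h)
  · have := e.left_inv hmem
    rw [he0] at this
    simp [this]
  · intro y hy
    have h1 := e.right_inv hy
    rw [he] at h1
    have h2 : (e.symm (y, 0)).1 = y := congrArg Prod.fst h1
    have h3 : h (m (e.symm (y, 0))) = 0 := congrArg Prod.snd h1
    have h4 : m (e.symm (y, 0)) ∈ O := hsub (e.map_target hy)
    simp only [m, h2] at h3 h4
    exact ⟨h4, h3⟩

end FlowBox

/-! ### Christoffel symbols in a vector space -/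

section Christoffel

set_option synthInstance.maxHeartbeats 400000

variable {V : Type*} [NormedAddCommGroup V] [NormedSpace ℝ V]

lemma isInvertible_of_nondegenerate [FiniteDimensional ℝ V] {b : V →L[ℝ] V →L[ℝ] ℝ}
    (hb : ∀ u, (∀ w, b u w = 0) → u = 0) : b.IsInvertible := by
  have hinj : Function.Injective (b : V →ₗ[ℝ] V →L[ℝ] ℝ) := by
    rw [← LinearMap.ker_eq_bot, LinearMap.ker_eq_bot']
    intro u hu
    exact hb u fun w ↦ by rw [show b u = 0 from hu]; rfl
  have hdim : Module.finrank ℝ V = Module.finrank ℝ (V →L[ℝ] ℝ) := by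
    rw [← (LinearMap.toContinuousLinearMap (𝕜 := ℝ) (E := V) (F' := ℝ)).finrank_eq]
    exact (Subspace.dual_finrank_eq (K := ℝ) (V := V)).symm
  exact ⟨(LinearMap.linearEquivOfInjective _ hinj hdim).toContinuousLinearEquiv, by ext u; rfl⟩

variable {G : V → V →L[ℝ] V →L[ℝ] ℝ} {y : V}

lemma apply_christoffelSymbols (hG : (G y).IsInvertible) (u w z : V) :
    G y (christoffelSymbols G y u w) z =
      (1 / 2 : ℝ) * (fderiv ℝ G y u w z + fderiv ℝ G y w u z - fderiv ℝ G y z u w) := by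
  rw [christoffelSymbols, hG.self_apply_inverse]
  simp

lemma exists_hasFDerivAt_apply_apply {E : Type*} [NormedAddCommGroup E] [NormedSpace ℝ E]
    {F : E → V →L[ℝ] V →L[ℝ] ℝ} {F' : E →L[ℝ] V →L[ℝ] V →L[ℝ] ℝ} {a b : E → V} {a' b' : E →L[ℝ] V}
    {p : E} (hF : HasFDerivAt F F' p) (ha : HasFDerivAt a a' p) (hb : HasFDerivAt b b' p) :
    ∃ L : E →L[ℝ] ℝ, HasFDerivAt (fun z ↦ F z (a z) (b z)) L p ∧
      ∀ k, L k = F' k (a p) (b p) + F p (a' k) (b p) + F p (a p) (b' k) := by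
  have h1 := HasFDerivAt.clm_apply hF ha
  refine ⟨_, h1.clm_apply hb, fun k ↦ ?_⟩
  simp
  ring

lemma hasFDerivAt_apply_const (hd : DifferentiableAt ℝ G y) (u w : V) :
    HasFDerivAt (fun z ↦ G z u w) (((fderiv ℝ G y).flip u).flip w) y := by
  obtain ⟨L, hL, hL'⟩ := exists_hasFDerivAt_apply_apply hd.hasFDerivAt (hasFDerivAt_const u y)
    (hasFDerivAt_const w y)
  refine hL.congr_fderiv (ContinuousLinearMap.ext fun k ↦ ?_)
  simp [hL']

lemma fderiv_apply_apply (hd : DifferentiableAt ℝ G y) (a u w : V) :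
    fderiv ℝ G y a u w = fderiv ℝ (fun z ↦ G z u w) y a := by
  rw [(hasFDerivAt_apply_const hd u w).fderiv]
  rfl

lemma fderiv_symm (hd : DifferentiableAt ℝ G y)
    (hs : ∀ᶠ z in 𝓝 y, ∀ u w, G z u w = G z w u) (a u w : V) :
    fderiv ℝ G y a u w = fderiv ℝ G y a w u := by
  rw [fderiv_apply_apply hd, fderiv_apply_apply hd]
  rw [Filter.EventuallyEq.fderiv_eq (hs.mono fun z hz ↦ hz u w)]

lemma christoffelSymbols_symm (hd : DifferentiableAt ℝ G y)
    (hs : ∀ᶠ z in 𝓝 y, ∀ u w, G z u w = G z w u) (u w : V) :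
    christoffelSymbols G y u w = christoffelSymbols G y w u := by
  unfold christoffelSymbols
  congr 2
  ext z
  simp [fderiv_symm hd hs z u w]
  ring

lemma christoffelSymbols_add_smul_left (u₁ u₂ w : V) (a : ℝ) :
    christoffelSymbols G y (u₁ + a • u₂) w =
      christoffelSymbols G y u₁ w + a • christoffelSymbols G y u₂ w := by
  unfold christoffelSymbols
  rw [← map_smul, ← map_add]
  congr 1
  ext z
  simp
  ring

lemma christoffelSymbols_smul_right (u w : V) (a : ℝ) :
    christoffelSymbols G y u (a • w) = a • christoffelSymbols G y u w := by
  unfold christoffelSymbols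
  rw [← map_smul]
  congr 1
  ext z
  simp
  ring

/-- The Levi-Civita connection is metric. -/
lemma fderiv_eq_christoffelSymbols (hG : (G y).IsInvertible) (hd : DifferentiableAt ℝ G y)
    (hs : ∀ᶠ z in 𝓝 y, ∀ u w, G z u w = G z w u) (a u w : V) :
    fderiv ℝ G y a u w =
      G y (christoffelSymbols G y a u) w + G y (christoffelSymbols G y a w) u := by
  rw [apply_christoffelSymbols hG, apply_christoffelSymbols hG, fderiv_symm hd hs a w u,
    fderiv_symm hd hs u a w, fderiv_symm hd hs w a u]
  ring

/-- The transformation law of Christoffel symbols: if `G'` is the pullback of `G` under `ψ`,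
then `dψ (Γ'(u, w)) = Γ(dψ u, dψ w) + d²ψ(u, w)`. -/
theorem christoffelSymbols_pullback {G' : V → V →L[ℝ] V →L[ℝ] ℝ} {ψ : V → V}
    (hψ : ContDiffAt ℝ 2 ψ y) (hψs : Function.Surjective (fderiv ℝ ψ y))
    (hG : (G (ψ y)).IsInvertible) (hd : DifferentiableAt ℝ G (ψ y))
    (hs : ∀ᶠ z in 𝓝 (ψ y), ∀ u w, G z u w = G z w u)
    (hG' : (G' y).IsInvertible) (hd' : DifferentiableAt ℝ G' y)
    (h : ∀ᶠ z in 𝓝 y, ∀ u w, G' z u w = G (ψ z) (fderiv ℝ ψ z u) (fderiv ℝ ψ z w)) (u w : V) :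
    fderiv ℝ ψ y (christoffelSymbols G' y u w) =
      christoffelSymbols G (ψ y) (fderiv ℝ ψ y u) (fderiv ℝ ψ y w) +
        fderiv ℝ (fderiv ℝ ψ) y u w := by
  set D := fderiv ℝ ψ y
  set D2 := fderiv ℝ (fderiv ℝ ψ) y
  have hD : HasFDerivAt ψ D y := (hψ.differentiableAt (by simp)).hasFDerivAt
  have hD2 : HasFDerivAt (fderiv ℝ ψ) D2 y :=
    ((hψ.fderiv_right (m := 1) (by norm_num)).differentiableAt (by simp)).hasFDerivAt
  have hsymm2 : ∀ a b, D2 a b = D2 b a := fun a b ↦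
    (hψ.isSymmSndFDerivAt (by simp)).eq a b
  have hsy : ∀ a b, G (ψ y) a b = G (ψ y) b a := hs.self_of_nhds
  have hGψ : HasFDerivAt (fun z ↦ G (ψ z)) ((fderiv ℝ G (ψ y)) ∘L D) y :=
    HasFDerivAt.comp (G := V →L[ℝ] V →L[ℝ] ℝ) y hd.hasFDerivAt hD
  have key : ∀ a u w, fderiv ℝ G' y a u w = fderiv ℝ G (ψ y) (D a) (D u) (D w) +
      G (ψ y) (D2 a u) (D w) + G (ψ y) (D u) (D2 a w) := by
    intro a u w
    rw [fderiv_apply_apply hd', Filter.EventuallyEq.fderiv_eq (h.mono fun z hz ↦ hz u w)]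
    obtain ⟨L, hL, hL'⟩ := exists_hasFDerivAt_apply_apply hGψ
      (hD2.clm_apply (hasFDerivAt_const u y)) (hD2.clm_apply (hasFDerivAt_const w y))
    rw [hL.fderiv, hL']
    simp [D]
  have hb := h.self_of_nhds
  have hinj : ∀ a, (∀ z, G (ψ y) a (D z) = 0) → a = 0 := by
    intro a ha
    obtain ⟨L, hL⟩ := hG
    apply L.injective
    rw [map_zero]
    ext z
    obtain ⟨z, rfl⟩ := hψs z
    have := ha z
    rw [← hL] at this
    exact this
  rw [← sub_eq_zero]
  refine hinj _ fun z ↦ ?_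
  have e1 := apply_christoffelSymbols hG' u w z
  rw [hb] at e1
  have e2 := apply_christoffelSymbols hG (D u) (D w) (D z)
  rw [map_sub, map_add, sub_apply, add_apply, e1, e2,
    key, key, key, hsymm2 w u, hsymm2 z u, hsymm2 z w, hsy (D w) (D2 u z), hsy (D u) (D2 w z)]
  ring

/-- The Levi-Civita covariant derivative is natural under pullback. -/
theorem covDeriv_pullback {G' : V → V →L[ℝ] V →L[ℝ] ℝ} {ψ : V → V}
    (hψ : ContDiffAt ℝ 2 ψ y) {X X' : V → V} (hX : DifferentiableAt ℝ X (ψ y))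
    (hX' : DifferentiableAt ℝ X' y)
    (hXX' : ∀ᶠ z in 𝓝 y, fderiv ℝ ψ z (X' z) = X (ψ z))
    (h : ∀ u w, fderiv ℝ ψ y (christoffelSymbols G' y u w) =
      christoffelSymbols G (ψ y) (fderiv ℝ ψ y u) (fderiv ℝ ψ y w) +
        fderiv ℝ (fderiv ℝ ψ) y u w) (u : V) :
    fderiv ℝ ψ y (fderiv ℝ X' y u + christoffelSymbols G' y u (X' y)) =
      fderiv ℝ X (ψ y) (fderiv ℝ ψ y u) +
        christoffelSymbols G (ψ y) (fderiv ℝ ψ y u) (X (ψ y)) := by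
  have hD : HasFDerivAt ψ (fderiv ℝ ψ y) y := (hψ.differentiableAt (by simp)).hasFDerivAt
  have hD2 : HasFDerivAt (fderiv ℝ ψ) (fderiv ℝ (fderiv ℝ ψ) y) y :=
    ((hψ.fderiv_right (m := 1) (by norm_num)).differentiableAt (by simp)).hasFDerivAt
  have h1 := (hD2.clm_apply hX'.hasFDerivAt).fderiv
  have h2 : fderiv ℝ (fun z ↦ fderiv ℝ ψ z (X' z)) y = _ := Filter.EventuallyEq.fderiv_eq hXX'
  have h3 := (hX.hasFDerivAt.comp y hD).fderiv
  have h4 := congrArg (fun L ↦ L u) (h1.symm.trans (h2.trans h3))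
  simp only [add_apply, ContinuousLinearMap.comp_apply,
    ContinuousLinearMap.flip_apply] at h4
  rw [map_add, h, ← hXX'.self_of_nhds, ← h4]
  abel

/-- A bundle map `(y, Y) ↦ (ψ y, B y Y)` that intertwines two connections takes parallel fields
to parallel fields. -/
theorem hasDerivWithinAt_parallel {Γ Γ' : V → V → V} {s : Set ℝ} {t : ℝ} {x Y : ℝ → V} {x' : V}
    {ψ : V → V} {B : V → V →L[ℝ] V} (hB : DifferentiableAt ℝ B (x t))
    (h : ∀ u w, B (x t) (Γ u w) = Γ' (fderiv ℝ ψ (x t) u) (B (x t) w) + fderiv ℝ B (x t) u w)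
    (hx : HasDerivWithinAt x x' s t) (hY : HasDerivWithinAt Y (-Γ x' (Y t)) s t) :
    HasDerivWithinAt (fun τ ↦ B (x τ) (Y τ)) (-Γ' (fderiv ℝ ψ (x t) x') (B (x t) (Y t))) s t := by
  convert (hB.hasFDerivAt.comp_hasDerivWithinAt t hx).clm_apply hY using 1
  simp only [Function.comp_apply]
  rw [map_neg, Function.comp_apply, h]
  abel

section Translation

variable {c : ℝ} {v₀ : V} {O : Set V}

/-- If `∇ v₀ = (c/2) id` for a constant field `v₀`, then `G` is multiplied by `e^{cs}` under the
translation by `s v₀`, which is the flow of `v₀`. -/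
theorem apply_add_smul (hO : IsOpen O) (hconv : Convex ℝ O) (hG : ∀ y ∈ O, (G y).IsInvertible)
    (hd : ∀ y ∈ O, DifferentiableAt ℝ G y) (hs : ∀ y ∈ O, ∀ u w, G y u w = G y w u)
    (hv : ∀ y ∈ O, ∀ u, christoffelSymbols G y u v₀ = (c / 2) • u) {s : ℝ} (hy : y ∈ O)
    (hys : y + s • v₀ ∈ O) : G (y + s • v₀) = Real.exp (c * s) • G y := by
  have hs' : ∀ y ∈ O, ∀ᶠ z in 𝓝 y, ∀ u w, G z u w = G z w u := fun y hy ↦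
    Filter.eventually_of_mem (hO.mem_nhds hy) hs
  have hkill : ∀ y ∈ O, ∀ u w, fderiv ℝ G y v₀ u w = c * G y u w := by
    intro y hy u w
    rw [fderiv_eq_christoffelSymbols (hG y hy) (hd y hy) (hs' y hy),
      christoffelSymbols_symm (hd y hy) (hs' y hy) v₀,
      christoffelSymbols_symm (hd y hy) (hs' y hy) v₀, hv y hy, hv y hy]
    simp only [map_smul, smul_apply]
    rw [hs y hy w u, ← add_smul, add_halves, smul_eq_mul]
  ext u w
  have hl : ∀ t, HasDerivAt (fun t : ℝ ↦ y + t • v₀) v₀ t := fun t ↦ by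
    simpa using ((hasDerivAt_id t).smul_const v₀).const_add y
  set J : Set ℝ := (fun t : ℝ ↦ y + t • v₀) ⁻¹' O
  have hJo : IsOpen J := hO.preimage (by fun_prop)
  have hJc : Convex ℝ J := by
    intro a ha b hb p q hp hq hpq
    have := hconv ha hb hp hq hpq
    simp only [J, mem_preimage] at this ⊢
    convert this using 1
    rw [smul_add, smul_add, add_add_add_comm, ← add_smul, hpq, one_smul, add_smul, smul_assoc,
      smul_assoc]
  have hderiv : ∀ t ∈ J, HasDerivAt (fun t ↦ Real.exp (-c * t) * G (y + t • v₀) u w) 0 t := by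
    intro t ht
    have h1 : HasDerivAt (fun t ↦ G (y + t • v₀) u w) (c * G (y + t • v₀) u w) t := by
      rw [← hkill _ ht]
      exact (hasFDerivAt_apply_const (hd _ ht) u w).comp_hasDerivAt t (hl t)
    have h2 : HasDerivAt (fun t ↦ Real.exp (-c * t)) (Real.exp (-c * t) * -c) t := by
      simpa using ((hasDerivAt_id t).const_mul (-c)).exp
    refine (h2.mul h1).congr_deriv ?_
    ring
  have hconst := hJo.is_const_of_deriv_eq_zero hJc.isPreconnected
    (f := fun t ↦ Real.exp (-c * t) * G (y + t • v₀) u w)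
    (fun t ht ↦ (hderiv t ht).differentiableAt.differentiableWithinAt)
    (fun t ht ↦ (hderiv t ht).deriv) (x := s) (y := 0) hys (by simpa [J] using hy)
  simp only [mul_zero, Real.exp_zero, zero_smul, add_zero, one_mul] at hconst
  simp only [smul_apply, smul_eq_mul]
  rw [← hconst, ← mul_assoc, ← Real.exp_add]
  simp

/-- The connection is invariant under the flow of `v₀`, since the metric only changes by a constant
factor. -/
theorem christoffelSymbols_add_smul (hO : IsOpen O) (hconv : Convex ℝ O)
    (hG : ∀ y ∈ O, (G y).IsInvertible)
    (hd : ∀ y ∈ O, DifferentiableAt ℝ G y) (hs : ∀ y ∈ O, ∀ u w, G y u w = G y w u)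
    (hv : ∀ y ∈ O, ∀ u, christoffelSymbols G y u v₀ = (c / 2) • u) {s : ℝ} (hy : y ∈ O)
    (hys : y + s • v₀ ∈ O) (u w : V) :
    christoffelSymbols G (y + s • v₀) u w = christoffelSymbols G y u w := by
  have h1 : (fun z ↦ G (z + s • v₀)) =ᶠ[𝓝 y] fun z ↦ Real.exp (c * s) • G z := by
    have hc : ContinuousAt (fun z ↦ z + s • v₀) y := by fun_prop
    filter_upwards [hO.mem_nhds hy, hc.preimage_mem_nhds (hO.mem_nhds hys)] with z hz hz'
    exact apply_add_smul hO hconv hG hd hs hv hz hz'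
  have h2 : fderiv ℝ G (y + s • v₀) = Real.exp (c * s) • fderiv ℝ G y := by
    have h0 : fderiv ℝ (fun z ↦ G (z + s • v₀)) y = fderiv ℝ G (y + s • v₀) :=
      fderiv_comp_add_right (𝕜 := ℝ) (F := V →L[ℝ] V →L[ℝ] ℝ) (f := G) (x := y) (s • v₀)
    rw [← h0, h1.fderiv_eq]
    exact fderiv_fun_const_smul (𝕜 := ℝ) (F := V →L[ℝ] V →L[ℝ] ℝ) (hd y hy) (Real.exp (c * s))
  have h3 : Function.Injective (G (y + s • v₀)) := by
    obtain ⟨L, hL⟩ := hG _ hys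
    rw [← hL]; exact L.injective
  apply h3
  ext z
  have h4 := apply_christoffelSymbols (hG y hy) u w z
  rw [apply_christoffelSymbols (hG _ hys), h2, apply_add_smul hO hconv hG hd hs hv hy hys]
  simp only [smul_apply, smul_eq_mul]
  rw [h4]
  ring

/-- The shift `y ↦ y + σ(y) v₀` along the flow, together with the factor `e^{-cσ/2}` on vectors,
intertwines the connection with itself: the factor cancels the term `Γ(v₀, ·) = c/2` that comes
from the motion along the flow. -/
theorem shift_intertwines (hO : IsOpen O) (hconv : Convex ℝ O) (hG : ∀ y ∈ O, (G y).IsInvertible)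
    (hd : ∀ y ∈ O, DifferentiableAt ℝ G y) (hs : ∀ y ∈ O, ∀ u w, G y u w = G y w u)
    (hv : ∀ y ∈ O, ∀ u, christoffelSymbols G y u v₀ = (c / 2) • u) {σ : V → ℝ} (hy : y ∈ O)
    (hσ : DifferentiableAt ℝ σ y) (hys : y + σ y • v₀ ∈ O) (u w : V) :
    (Real.exp (-(c / 2) * σ y) • ContinuousLinearMap.id ℝ V) (christoffelSymbols G y u w) =
      christoffelSymbols G (y + σ y • v₀) (fderiv ℝ (fun z ↦ z + σ z • v₀) y u)
        ((Real.exp (-(c / 2) * σ y) • ContinuousLinearMap.id ℝ V) w) +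
      fderiv ℝ (fun z ↦ Real.exp (-(c / 2) * σ z) • ContinuousLinearMap.id ℝ V) y u w := by
  have hs' : ∀ᶠ z in 𝓝 y, ∀ u w, G z u w = G z w u :=
    Filter.eventually_of_mem (hO.mem_nhds hy) hs
  have h1 : HasFDerivAt (fun z ↦ z + σ z • v₀)
      (ContinuousLinearMap.id ℝ V + (fderiv ℝ σ y).smulRight v₀) y :=
    (hasFDerivAt_id y).add (hσ.hasFDerivAt.smul_const v₀)
  have h2 := ((hσ.hasFDerivAt.const_mul (-(c / 2))).exp).smul_const (ContinuousLinearMap.id ℝ V)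
  rw [h1.fderiv, h2.fderiv, christoffelSymbols_add_smul hO hconv hG hd hs hv hy hys]
  simp only [add_apply, ContinuousLinearMap.smulRight_apply,
    smul_apply, ContinuousLinearMap.id_apply, smul_eq_mul]
  rw [christoffelSymbols_add_smul_left, christoffelSymbols_smul_right,
    christoffelSymbols_symm (hd y hy) hs' v₀, hv y hy]
  module

end Translation

end Christoffel

/-! ### Smooth charts -/

section Charts

variable {n : ℕ} {M : Type*} [TopologicalSpace M] [ChartedSpace (EuclideanSpace ℝ (Fin n)) M]

/-- A chart of the maximal atlas, given by its smoothness in both directions. -/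
structure IsSmoothChart (e : OpenPartialHomeomorph M (Model n)) : Prop where
  smooth : ContMDiffOn (𝓡 n) 𝓘(ℝ, Model n) ∞ e e.source
  smooth_symm : ContMDiffOn 𝓘(ℝ, Model n) (𝓡 n) ∞ e.symm e.target

/-- The differential of a chart, with the tangent space identified with the model space, as it is
by definition in Mathlib. -/
def coordDiff (e : OpenPartialHomeomorph M (Model n)) (p : M) : Model n →L[ℝ] Model n :=
  mfderiv (𝓡 n) 𝓘(ℝ, Model n) e p

/-- The differential of the inverse of a chart. -/
def coordDiffSymm (e : OpenPartialHomeomorph M (Model n)) (y : Model n) : Model n →L[ℝ] Model n :=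
  mfderiv 𝓘(ℝ, Model n) (𝓡 n) e.symm y

namespace IsSmoothChart

lemma chartAt [IsManifold (𝓡 n) ∞ M] (x₀ : M) : IsSmoothChart (chartAt (Model n) x₀) :=
  ⟨contMDiffOn_chart, contMDiffOn_chart_symm⟩

variable {e e' : OpenPartialHomeomorph M (Model n)} (he : IsSmoothChart e)
  (he' : IsSmoothChart e')
include he

lemma contMDiffAt {p : M} (hp : p ∈ e.source) : ContMDiffAt (𝓡 n) 𝓘(ℝ, Model n) ∞ e p :=
  he.smooth.contMDiffAt (e.open_source.mem_nhds hp)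

lemma contMDiffAt_symm {y : Model n} (hy : y ∈ e.target) :
    ContMDiffAt 𝓘(ℝ, Model n) (𝓡 n) ∞ e.symm y :=
  he.smooth_symm.contMDiffAt (e.open_target.mem_nhds hy)

lemma hasMFDerivAt {p : M} (hp : p ∈ e.source) :
    HasMFDerivAt (𝓡 n) 𝓘(ℝ, Model n) e p (coordDiff e p) :=
  ((he.contMDiffAt hp).mdifferentiableAt (by simp)).hasMFDerivAt

lemma hasMFDerivAt_symm {y : Model n} (hy : y ∈ e.target) :
    HasMFDerivAt 𝓘(ℝ, Model n) (𝓡 n) e.symm y (coordDiffSymm e y) :=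
  ((he.contMDiffAt_symm hy).mdifferentiableAt (by simp)).hasMFDerivAt

include he' in
/-- The differential of a transition map. -/
lemma hasFDerivAt_transition {y : Model n} (hy : y ∈ e.target) (hy' : e.symm y ∈ e'.source) :
    HasFDerivAt (e' ∘ e.symm) (coordDiff e' (e.symm y) ∘L coordDiffSymm e y) y :=
  ((he'.hasMFDerivAt hy').comp y (he.hasMFDerivAt_symm hy)).hasFDerivAt

lemma coordDiff_coordDiffSymm {y : Model n} (hy : y ∈ e.target) (u : Model n) :
    coordDiff e (e.symm y) (coordDiffSymm e y u) = u := by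
  have h1 := he.hasFDerivAt_transition he hy (e.map_target hy)
  have h2 : HasFDerivAt (e ∘ e.symm) (ContinuousLinearMap.id ℝ (Model n)) y :=
    (hasFDerivAt_id y).congr_of_eventuallyEq
      (Filter.eventuallyEq_of_mem (e.open_target.mem_nhds hy) fun z hz ↦ e.right_inv hz)
  exact congrArg (fun L : Model n →L[ℝ] Model n ↦ L u) (h1.unique h2)

lemma coordDiffSymm_coordDiff {p : M} (hp : p ∈ e.source) (u : Model n) :
    coordDiffSymm e (e p) (coordDiff e p u) = u := by
  have hinj : Function.Injective (coordDiffSymm e (e p)) := fun a b hab ↦ by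
    rw [← he.coordDiff_coordDiffSymm (e.map_source hp) a, hab,
      he.coordDiff_coordDiffSymm (e.map_source hp) b]
  obtain ⟨w, rfl⟩ := (LinearMap.injective_iff_surjective
    (f := (coordDiffSymm e (e p) : Model n →ₗ[ℝ] Model n))).1 hinj u
  have := he.coordDiff_coordDiffSymm (e.map_source hp) w
  rw [e.left_inv hp] at this
  exact congrArg _ this

include he' in
lemma contDiffAt_transition {y : Model n} (hy : y ∈ e.target) (hy' : e.symm y ∈ e'.source) :
    ContDiffAt ℝ ∞ (e' ∘ e.symm) y :=
  ((he'.contMDiffAt hy').comp y (he.contMDiffAt_symm hy)).contDiffAt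

include he' in
lemma fderiv_transition {y : Model n} (hy : y ∈ e.target) (hy' : e.symm y ∈ e'.source)
    (u : Model n) :
    fderiv ℝ (e' ∘ e.symm) y u = coordDiff e' (e.symm y) (coordDiffSymm e y u) := by
  rw [(he.hasFDerivAt_transition he' hy hy').fderiv]; rfl

include he' in
lemma fderiv_transition_coordDiff {p : M} (hp : p ∈ e.source) (hp' : p ∈ e'.source)
    (u : Model n) :
    fderiv ℝ (e' ∘ e.symm) (e p) (coordDiff e p u) = coordDiff e' p u := by
  rw [he.fderiv_transition he' (e.map_source hp) (by rwa [e.left_inv hp]),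
    he.coordDiffSymm_coordDiff hp, e.left_inv hp]

include he' in
lemma coordDiffSymm_fderiv_transition {y : Model n} (hy : y ∈ e.target)
    (hy' : e.symm y ∈ e'.source) (u : Model n) :
    coordDiffSymm e' ((e' ∘ e.symm) y) (fderiv ℝ (e' ∘ e.symm) y u) = coordDiffSymm e y u := by
  rw [he.fderiv_transition he' hy hy']
  exact he'.coordDiffSymm_coordDiff hy' _

include he' in
lemma surjective_fderiv_transition {y : Model n} (hy : y ∈ e.target)
    (hy' : e.symm y ∈ e'.source) : Function.Surjective (fderiv ℝ (e' ∘ e.symm) y) := by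
  intro u
  refine ⟨coordDiff e (e.symm y) (coordDiffSymm e' (e' (e.symm y)) u), ?_⟩
  rw [he.fderiv_transition he' hy hy']
  have h1 := he.coordDiffSymm_coordDiff (e.map_target hy) (coordDiffSymm e' (e' (e.symm y)) u)
  rw [e.right_inv hy] at h1
  rw [h1]
  have h2 := he'.coordDiff_coordDiffSymm (e'.map_source hy') u
  rwa [e'.left_inv hy'] at h2

lemma differentiableWithinAt_comp {γ : ℝ → M} {t : ℝ}
    (hγ : MDifferentiableWithinAt 𝓘(ℝ, ℝ) (𝓡 n) γ (Icc 0 1) t) (hs : γ t ∈ e.source) :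
    DifferentiableWithinAt ℝ (e ∘ γ) (Icc 0 1) t :=
  (((he.contMDiffAt hs).mdifferentiableAt (by simp)).comp_mdifferentiableWithinAt t
    hγ).differentiableWithinAt

end IsSmoothChart

/-- A vector field in a chart. -/
def fieldIn (v : ∀ x : M, TangentSpace (𝓡 n) x) (e : OpenPartialHomeomorph M (Model n))
    (y : Model n) : Model n :=
  coordDiff e (e.symm y) (v (e.symm y))

variable [IsManifold (𝓡 n) ∞ M] (g : PseudoRiemannianMetric n M)

/-- The metric in a chart. -/
def metricIn (e : OpenPartialHomeomorph M (Model n)) (y : Model n) :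
    Model n →L[ℝ] Model n →L[ℝ] ℝ :=
  (mfderiv 𝓘(ℝ, Model n) (𝓡 n) e.symm y).precomp ℝ ∘L g.val (e.symm y) ∘L
    mfderiv 𝓘(ℝ, Model n) (𝓡 n) e.symm y

lemma metricIn_apply (e : OpenPartialHomeomorph M (Model n)) (y u w : Model n) :
    metricIn g e y u w = g.val (e.symm y) (coordDiffSymm e y u) (coordDiffSymm e y w) := rfl

lemma metricIn_symm (e : OpenPartialHomeomorph M (Model n)) (y u w : Model n) :
    metricIn g e y u w = metricIn g e y w u :=
  g.symm _ _ _

variable {e e' : OpenPartialHomeomorph M (Model n)}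

lemma isInvertible_metricIn (he : IsSmoothChart e) {y : Model n} (hy : y ∈ e.target) :
    (metricIn g e y).IsInvertible := by
  refine isInvertible_of_nondegenerate fun u hu ↦ ?_
  have h1 : coordDiffSymm e y u = (0 : Model n) := by
    refine g.nondegenerate (e.symm y) (coordDiffSymm e y u) fun w ↦ ?_
    have h2 := hu (coordDiff e (e.symm y) w)
    rw [metricIn_apply] at h2
    have h3 := he.coordDiffSymm_coordDiff (e.map_target hy) w
    rw [e.right_inv hy] at h3
    rwa [h3] at h2
  rw [← he.coordDiff_coordDiffSymm hy u, h1, map_zero]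

lemma contMDiffOn_coordDiffSymm (he : IsSmoothChart e) (u : Model n) :
    ContMDiffOn 𝓘(ℝ, Model n) (𝓡 n).tangent ∞
      (fun y ↦ (⟨e.symm y, coordDiffSymm e y u⟩ : TangentBundle (𝓡 n) M)) e.target := by
  have : IsManifold (𝓡 n) 1 M := IsManifold.of_le (n := ∞) (by simp)
  have h1 := he.smooth_symm.contMDiffOn_tangentMapWithin (m := ∞) (by simp)
    e.open_target.uniqueMDiffOn
  have h2 : ContMDiff 𝓘(ℝ, Model n) 𝓘(ℝ, Model n).tangent ∞
      (fun y ↦ (⟨y, u⟩ : TangentBundle 𝓘(ℝ, Model n) (Model n))) := by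
    intro y
    exact contMDiffAt_vectorSpace_iff_contDiffAt.2 contDiffAt_const
  refine (h1.comp h2.contMDiffOn fun y hy ↦ hy).congr fun y hy ↦ ?_
  simp only [tangentMapWithin, Function.comp_apply, mfderivWithin_of_isOpen e.open_target hy]
  rfl

lemma contDiffOn_metricIn (he : IsSmoothChart e) :
    ContDiffOn ℝ ∞ (metricIn g e) e.target := by
  refine contDiffOn_clm_apply.2 fun u ↦ contDiffOn_clm_apply.2 fun w ↦ ?_
  have h1 : ContMDiffOn 𝓘(ℝ, Model n) ((𝓡 n).prod 𝓘(ℝ, Model n →L[ℝ] Model n →L[ℝ] ℝ)) ∞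
      (fun y ↦ TotalSpace.mk' (Model n →L[ℝ] Model n →L[ℝ] ℝ)
        (E := fun x : M ↦ (TangentSpace (𝓡 n) x →L[ℝ] TangentSpace (𝓡 n) x →L[ℝ] ℝ))
        (e.symm y) (g.val (e.symm y))) e.target :=
    g.contMDiff.comp_contMDiffOn he.smooth_symm
  have h2 := ContMDiffOn.clm_bundle_apply₂ (F₁ := Model n) (F₂ := Model n) (F₃ := ℝ)
    (E₃ := Bundle.Trivial M ℝ) h1 (contMDiffOn_coordDiffSymm he u) (contMDiffOn_coordDiffSymm he w)
  intro y hy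
  have h3 := (Bundle.contMDiffWithinAt_totalSpace.1 (h2 y hy)).2
  exact h3.contDiffWithinAt

lemma differentiableAt_metricIn (he : IsSmoothChart e) {y : Model n} (hy : y ∈ e.target) :
    DifferentiableAt ℝ (metricIn g e) y :=
  DifferentiableOn.differentiableAt (F := Model n →L[ℝ] Model n →L[ℝ] ℝ)
    ((contDiffOn_metricIn g he).differentiableOn (by simp)) (e.open_target.mem_nhds hy)

lemma contDiffOn_fieldIn {v : ∀ x : M, TangentSpace (𝓡 n) x}
    (hv : ContMDiff (𝓡 n) (𝓡 n).tangent ∞ (fun x ↦ (⟨x, v x⟩ : TangentBundle (𝓡 n) M)))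
    (he : IsSmoothChart e) : ContDiffOn ℝ ∞ (fieldIn v e) e.target := by
  have : IsManifold (𝓡 n) 1 M := IsManifold.of_le (n := ∞) (by simp)
  have h1 := he.smooth.contMDiffOn_tangentMapWithin (m := ∞) (by simp)
    e.open_source.uniqueMDiffOn
  have h2 := (contMDiff_snd_tangentBundle_modelSpace (Model n) 𝓘(ℝ, Model n)
    (n := ∞)).comp_contMDiffOn ((h1.comp hv.contMDiffOn fun x hx ↦ hx).comp he.smooth_symm
      fun y hy ↦ e.map_target hy)
  refine (contMDiffOn_iff_contDiffOn.1 h2).congr fun y hy ↦ ?_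
  change coordDiff e (e.symm y) (v (e.symm y)) =
    mfderivWithin (𝓡 n) 𝓘(ℝ, Model n) e e.source (e.symm y) (v (e.symm y))
  rw [mfderivWithin_of_isOpen e.open_source (e.map_target hy)]
  rfl

/-- The transformation law of the Christoffel symbols of `g` between two charts. -/
theorem christoffelSymbols_transition (he : IsSmoothChart e) (he' : IsSmoothChart e') {y : Model n}
    (hy : y ∈ e.target) (hy' : e.symm y ∈ e'.source) (u w : Model n) :
    fderiv ℝ (e' ∘ e.symm) y (christoffelSymbols (metricIn g e) y u w) =
      christoffelSymbols (metricIn g e') ((e' ∘ e.symm) y) (fderiv ℝ (e' ∘ e.symm) y u)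
        (fderiv ℝ (e' ∘ e.symm) y w) + fderiv ℝ (fderiv ℝ (e' ∘ e.symm)) y u w := by
  have hψy : (e' ∘ e.symm) y ∈ e'.target := e'.map_source hy'
  refine christoffelSymbols_pullback ((he.contDiffAt_transition he' hy hy').of_le ENat.LEInfty.out)
    (he.surjective_fderiv_transition he' hy hy') (isInvertible_metricIn g he' hψy)
    (differentiableAt_metricIn g he' hψy) (Filter.Eventually.of_forall fun z ↦ metricIn_symm g e' z)
    (isInvertible_metricIn g he hy) (differentiableAt_metricIn g he hy) ?_ u w
  have hopen : IsOpen (e.target ∩ e.symm ⁻¹' e'.source) :=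
    e.isOpen_inter_preimage_symm e'.open_source
  filter_upwards [hopen.mem_nhds ⟨hy, hy'⟩] with z hz u w
  rw [metricIn_apply, metricIn_apply, he.coordDiffSymm_fderiv_transition he' hz.1 hz.2,
    he.coordDiffSymm_fderiv_transition he' hz.1 hz.2, Function.comp_apply, e'.left_inv hz.2]

/-- The equation `∇ v = (c/2) id` of a homothetic gradient field holds in every smooth chart. -/
theorem covDeriv_fieldIn {v : ∀ x : M, TangentSpace (𝓡 n) x}
    (hv : ContMDiff (𝓡 n) (𝓡 n).tangent ∞ (fun x ↦ (⟨x, v x⟩ : TangentBundle (𝓡 n) M)))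
    {c : ℝ} (hc : ∀ x₀ : M, ∀ y ∈ (extChartAt (𝓡 n) x₀).target, ∀ u : Model n,
      g.covDerivInChart v x₀ y u = (c / 2) • u)
    (he : IsSmoothChart e) {y : Model n} (hy : y ∈ e.target) (u : Model n) :
    fderiv ℝ (fieldIn v e) y u + christoffelSymbols (metricIn g e) y u (fieldIn v e y) =
      (c / 2) • u := by
  set x₀ := e.symm y
  set e' := chartAt (Model n) x₀
  have he' : IsSmoothChart e' := .chartAt x₀
  have hy' : e.symm y ∈ e'.source := mem_chart_source _ x₀
  have hψy : (e' ∘ e.symm) y ∈ e'.target := e'.map_source hy'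
  have hinj : Function.Injective (fderiv ℝ (e' ∘ e.symm) y) :=
    (LinearMap.injective_iff_surjective (f := (fderiv ℝ (e' ∘ e.symm) y : Model n →ₗ[ℝ] Model n))).2
      (he.surjective_fderiv_transition he' hy hy')
  apply hinj
  have hopen : IsOpen (e.target ∩ e.symm ⁻¹' e'.source) :=
    e.isOpen_inter_preimage_symm e'.open_source
  rw [covDeriv_pullback (ψ := e' ∘ e.symm) (X := fieldIn v e') (X' := fieldIn v e)
    ((he.contDiffAt_transition he' hy hy').of_le ENat.LEInfty.out)
    (((contDiffOn_fieldIn hv he').contDiffAt (e'.open_target.mem_nhds hψy)).differentiableAt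
      (by simp))
    (((contDiffOn_fieldIn hv he).contDiffAt (e.open_target.mem_nhds hy)).differentiableAt (by simp))
    ?_ (christoffelSymbols_transition g he he' hy hy'), map_smul]
  · refine hc x₀ _ ?_ _
    rw [extChartAt_target]
    simpa using hψy
  · filter_upwards [hopen.mem_nhds ⟨hy, hy'⟩] with z hz
    have h1 := he.fderiv_transition_coordDiff he' (e.map_target hz.1) hz.2 (v (e.symm z))
    rw [e.right_inv hz.1] at h1
    rw [fieldIn, h1, fieldIn, Function.comp_apply, e'.left_inv hz.2]

/-! ### Parallel fields in charts -/

/-- The equation of a parallel field `W` along `γ`, at the parameter `t` and in the chart `e`. -/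
def IsParallelInChart (e : OpenPartialHomeomorph M (Model n)) (γ : ℝ → M)
    (W : ℝ → TangentBundle (𝓡 n) M) (t : ℝ) : Prop :=
  HasDerivWithinAt (fun s ↦ coordDiff e (W s).proj (W s).snd)
    (-christoffelSymbols (metricIn g e) (e (γ t)) (derivWithin (e ∘ γ) (Icc 0 1) t)
      (coordDiff e (W t).proj (W t).snd)) (Icc 0 1) t

variable {γ : ℝ → M} {W : ℝ → TangentBundle (𝓡 n) M} {t : ℝ}

/-- Parallelism does not depend on the chart. -/
theorem IsParallelInChart.transition (he : IsSmoothChart e) (he' : IsSmoothChart e')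
    (ht : t ∈ Icc (0 : ℝ) 1) (hγ : MDifferentiableWithinAt 𝓘(ℝ, ℝ) (𝓡 n) γ (Icc 0 1) t)
    (hW : ∀ s ∈ Icc (0 : ℝ) 1, (W s).proj = γ s) (hs : γ t ∈ e.source) (hs' : γ t ∈ e'.source)
    (h : IsParallelInChart g e γ W t) : IsParallelInChart g e' γ W t := by
  set ψ := e' ∘ e.symm
  have hy : e (γ t) ∈ e.target := e.map_source hs
  have hy' : e.symm (e (γ t)) ∈ e'.source := by rwa [e.left_inv hs]
  have hψ : ContDiffAt ℝ ∞ ψ (e (γ t)) := he.contDiffAt_transition he' hy hy'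
  have hx := (he.differentiableWithinAt_comp hγ hs).hasDerivWithinAt
  have hev : ∀ᶠ s in 𝓝[Icc 0 1] t, γ s ∈ e.source ∩ e'.source :=
    hγ.continuousWithinAt.preimage_mem_nhdsWithin
      ((e.open_source.inter e'.open_source).mem_nhds ⟨hs, hs'⟩)
  have hB : DifferentiableAt ℝ (fderiv ℝ ψ) (e (γ t)) :=
    (hψ.fderiv_right (m := ∞) (by simp)).differentiableAt (by simp)
  have key := hasDerivWithinAt_parallel (ψ := ψ) (x := e ∘ γ) hB
    (christoffelSymbols_transition g he he' hy hy') hx h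
  have hud : UniqueDiffWithinAt ℝ (Icc (0 : ℝ) 1) t := uniqueDiffOn_Icc zero_lt_one t ht
  have hd : derivWithin (e' ∘ γ) (Icc 0 1) t =
      fderiv ℝ ψ (e (γ t)) (derivWithin (e ∘ γ) (Icc 0 1) t) := by
    have h1 : HasDerivWithinAt (ψ ∘ (e ∘ γ))
        (fderiv ℝ ψ (e (γ t)) (derivWithin (e ∘ γ) (Icc 0 1) t))
        (Icc 0 1) t :=
      (hψ.differentiableAt (by simp)).hasFDerivAt.comp_hasDerivWithinAt t hx
    refine (h1.congr_of_eventuallyEq ?_ ?_).derivWithin hud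
    · filter_upwards [hev] with s hs
      simp [ψ, e.left_inv hs.1]
    · simp [ψ, e.left_inv hs]
  have hval : ∀ s ∈ Icc (0 : ℝ) 1, γ s ∈ e.source ∩ e'.source →
      coordDiff e' (W s).proj (W s).snd =
        fderiv ℝ ψ ((e ∘ γ) s) (coordDiff e (W s).proj (W s).snd) := by
    intro s hs hs2
    have h1 := he.fderiv_transition_coordDiff he' hs2.1 hs2.2 (W s).snd
    rw [hW s hs]
    exact h1.symm
  unfold IsParallelInChart
  rw [hd, hval t ht ⟨hs, hs'⟩]
  have hψγ : e' (γ t) = ψ ((e ∘ γ) t) := by simp [ψ, e.left_inv hs]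
  rw [hψγ]
  refine key.congr_of_eventuallyEq ?_ (hval t ht ⟨hs, hs'⟩)
  filter_upwards [hev, self_mem_nhdsWithin] with s hs hsI using hval s hsI hs

/-- `W` satisfies the equation of a parallel field along `γ` at the parameter `t`. -/
def IsParallelAt (γ : ℝ → M) (W : ℝ → TangentBundle (𝓡 n) M) (t : ℝ) : Prop :=
  ∀ x₀ : M, γ t ∈ (extChartAt (𝓡 n) x₀).source →
    HasDerivWithinAt (fun s ↦ components x₀ (W s).proj (W s).snd)
      (-g.christoffel x₀ (extChartAt (𝓡 n) x₀ (γ t))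
        (derivWithin (fun s ↦ extChartAt (𝓡 n) x₀ (γ s)) (Icc 0 1) t)
        (components x₀ (W t).proj (W t).snd))
      (Icc 0 1) t

theorem isParallelAt_iff (he : IsSmoothChart e) (ht : t ∈ Icc (0 : ℝ) 1)
    (hγ : MDifferentiableWithinAt 𝓘(ℝ, ℝ) (𝓡 n) γ (Icc 0 1) t)
    (hW : ∀ s ∈ Icc (0 : ℝ) 1, (W s).proj = γ s) (hs : γ t ∈ e.source) :
    IsParallelAt g γ W t ↔ IsParallelInChart g e γ W t := by
  constructor
  · intro h
    have h1 : IsParallelInChart g (chartAt (Model n) (γ t)) γ W t :=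
      h (γ t) (mem_extChartAt_source _)
    exact h1.transition g (.chartAt _) he ht hγ hW (mem_chart_source _ _) hs
  · intro h x₀ hx₀
    rw [extChartAt_source] at hx₀
    exact h.transition g he (.chartAt x₀) ht hγ hW hs hx₀

lemma isParallelAt_congr {γ' : ℝ → M} {W' : ℝ → TangentBundle (𝓡 n) M}
    (hγ : γ' =ᶠ[𝓝[Icc 0 1] t] γ) (hW : W' =ᶠ[𝓝[Icc 0 1] t] W) (ht : t ∈ Icc (0 : ℝ) 1)
    (h : IsParallelAt g γ W t) : IsParallelAt g γ' W' t := by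
  intro x₀ hx₀
  have hγt : γ' t = γ t := hγ.eq_of_nhdsWithin ht
  have hWt : W' t = W t := hW.eq_of_nhdsWithin ht
  have hd : derivWithin (fun s ↦ extChartAt (𝓡 n) x₀ (γ' s)) (Icc 0 1) t =
      derivWithin (fun s ↦ extChartAt (𝓡 n) x₀ (γ s)) (Icc 0 1) t :=
    Filter.EventuallyEq.derivWithin_eq (hγ.fun_comp _) (by simp [hγt])
  rw [hd, hγt, hWt]
  rw [hγt] at hx₀
  refine (h x₀ hx₀).congr_of_eventuallyEq ?_ (by rw [hWt])
  filter_upwards [hW] with s hs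
  rw [hs]

end Charts

/-! ### Flow boxes -/

section FlowTransport

variable {n : ℕ} {M : Type*} [TopologicalSpace M] [ChartedSpace (EuclideanSpace ℝ (Fin n)) M]

/-- A flow box of `v`: a smooth chart with convex range in which `v` is the constant field `v₀`, so
that the flow of `v` is translation in the direction `v₀`. The vector field is given as a map to the
model space, which each tangent space is by definition in Mathlib. -/
structure IsFlowBox (v : M → Model n) (v₀ : Model n)
    (e : OpenPartialHomeomorph M (Model n)) : Prop where
  chart : IsSmoothChart e
  convex : Convex ℝ e.target
  straight : ∀ p ∈ e.source, coordDiff e p (v p) = v₀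

theorem exists_flowBox [IsManifold (𝓡 n) ∞ M] {v : M → Model n}
    (hv : ContMDiff (𝓡 n) (𝓡 n).tangent ∞ (fun x ↦ (⟨x, v x⟩ : TangentBundle (𝓡 n) M)))
    {p : M} (hp : v p ≠ 0) :
    ∃ (v₀ : Model n) (e : OpenPartialHomeomorph M (Model n)), IsFlowBox v v₀ e ∧ p ∈ e.source := by
  set e₀ := chartAt (Model n) p
  have he₀ : IsSmoothChart e₀ := .chartAt p
  have hps : p ∈ e₀.source := mem_chart_source _ p
  have hval : ∀ x ∈ e₀.source, fieldIn v e₀ (e₀ x) = coordDiff e₀ x (v x) := fun x hx ↦ by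
    change coordDiff e₀ (e₀.symm (e₀ x)) (v (e₀.symm (e₀ x))) = _
    rw [e₀.left_inv hx]
  have hne : fieldIn v e₀ (e₀ p) ≠ 0 := by
    intro h
    rw [hval p hps] at h
    have := he₀.coordDiffSymm_coordDiff hps (v p)
    rw [h, map_zero] at this
    exact hp this.symm
  obtain ⟨r, Ψ, hr, hΨs, hΨ0, hΨt, hΨ, hΨ', hstraight⟩ :=
    exists_straightening e₀.open_target (contDiffOn_fieldIn hv he₀) (e₀.map_source hps) hne
  set e := e₀.trans Ψ.symm
  have htarget : e.target = Metric.ball 0 r := by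
    rw [OpenPartialHomeomorph.trans_target]
    simp only [OpenPartialHomeomorph.symm_target, OpenPartialHomeomorph.symm_symm]
    rw [hΨs, inter_eq_left]
    intro y hy
    exact hΨt (Ψ.map_source (hΨs ▸ hy))
  have hsource : ∀ x ∈ e.source, x ∈ e₀.source ∧ e₀ x ∈ Ψ.target := fun x hx ↦ by
    rw [OpenPartialHomeomorph.trans_source] at hx; exact hx
  have htarget' : ∀ y ∈ e.target, y ∈ Ψ.source ∧ Ψ y ∈ e₀.target := fun y hy ↦ by
    rw [htarget, ← hΨs] at hy
    exact ⟨hy, hΨt (Ψ.map_source hy)⟩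
  have he : IsSmoothChart e :=
    ⟨hΨ'.contMDiffOn.comp (he₀.smooth.mono fun x hx ↦ (hsource x hx).1)
        fun x hx ↦ (hsource x hx).2,
      he₀.smooth_symm.comp (hΨ.contMDiffOn.mono fun y hy ↦ (htarget' y hy).1)
        fun y hy ↦ (htarget' y hy).2⟩
  refine ⟨fieldIn v e₀ (e₀ p), e, ⟨he, ?_, ?_⟩, ?_⟩
  · rw [htarget]; exact convex_ball 0 r
  · intro x hx
    have hy := e.map_source hx
    have hxs := (hsource x hx).1
    have hy' : e.symm (e x) ∈ e₀.source := by rwa [e.left_inv hx]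
    have hinj : Function.Injective (fderiv ℝ (e₀ ∘ e.symm) (e x)) :=
      (LinearMap.injective_iff_surjective
        (f := (fderiv ℝ (e₀ ∘ e.symm) (e x) : Model n →ₗ[ℝ] Model n))).2
        (he.surjective_fderiv_transition he₀ hy hy')
    have hΨe : (e₀ ∘ e.symm) =ᶠ[𝓝 (e x)] Ψ := by
      filter_upwards [e.open_target.mem_nhds hy] with z hz
      exact e₀.right_inv (htarget' z hz).2
    apply hinj
    rw [he.fderiv_transition_coordDiff he₀ hx hxs, ← hval x hxs, hΨe.fderiv_eq,
      hstraight _ (htarget' _ hy).1, ← hΨe.self_of_nhds, Function.comp_apply, e.left_inv hx]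
  · rw [OpenPartialHomeomorph.trans_source]
    refine ⟨hps, ?_⟩
    rw [mem_preimage, Ψ.symm_source, ← hΨ0]
    exact Ψ.map_source (hΨs ▸ Metric.mem_ball_self hr)

namespace IsFlowBox

variable {v : M → Model n} {v₀ : Model n}
  {e : OpenPartialHomeomorph M (Model n)} (h : IsFlowBox v v₀ e)
include h

lemma coordDiffSymm_eq {y : Model n} (hy : y ∈ e.target) :
    coordDiffSymm e y v₀ = v (e.symm y) := by
  have h1 := h.chart.coordDiffSymm_coordDiff (e.map_target hy) (v (e.symm y))
  rwa [h.straight _ (e.map_target hy), e.right_inv hy] at h1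

lemma hasMFDerivAt_line {y : Model n} {t : ℝ} (hy : y + t • v₀ ∈ e.target) :
    HasMFDerivAt 𝓘(ℝ, ℝ) (𝓡 n) (fun t : ℝ ↦ e.symm (y + t • v₀)) t
      ((1 : ℝ →L[ℝ] ℝ).smulRight (v (e.symm (y + t • v₀)))) := by
  have h1 : HasFDerivAt (fun t : ℝ ↦ y + t • v₀) ((1 : ℝ →L[ℝ] ℝ).smulRight v₀) t := by
    have : HasDerivAt (fun t : ℝ ↦ y + t • v₀) v₀ t := by
      simpa using ((hasDerivAt_id t).smul_const v₀).const_add y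
    exact this.hasFDerivAt
  have h2 := (h.chart.hasMFDerivAt_symm hy).comp t h1.hasMFDerivAt
  have h3 : coordDiffSymm e (y + t • v₀) ∘L (1 : ℝ →L[ℝ] ℝ).smulRight v₀ =
      (1 : ℝ →L[ℝ] ℝ).smulRight (v (e.symm (y + t • v₀))) := by
    ext1
    simp [h.coordDiffSymm_eq hy]
  exact h2.congr_mfderiv h3

/-- In a flow box the integral curves are the lines in the direction `v₀`. -/
lemma mem_integralCurveTrace {y : Model n} {s : ℝ} (hy : y ∈ e.target)
    (hys : y + s • v₀ ∈ e.target) :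
    e.symm (y + s • v₀) ∈ integralCurveTrace v (e.symm y) := by
  set J : Set ℝ := (fun t : ℝ ↦ y + t • v₀) ⁻¹' e.target
  have hJ : IsOpen J := e.open_target.preimage (by fun_prop)
  have hJc : J.OrdConnected := by
    refine Convex.ordConnected fun a ha b hb p q hp hq hpq ↦ ?_
    have := h.convex ha hb hp hq hpq
    simp only [J, mem_preimage] at this ⊢
    convert this using 1
    rw [smul_add, smul_add, add_add_add_comm, ← add_smul, hpq, one_smul, add_smul, smul_assoc,
      smul_assoc]
  have hm : min 0 s ∈ J ∧ max 0 s ∈ J := by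
    have h0 : (0 : ℝ) ∈ J := by simpa [J] using hy
    rcases le_total 0 s with hs | hs <;> simp [hs, h0] <;> exact hys
  obtain ⟨ε₁, hε₁, h₁⟩ := Metric.isOpen_iff.1 hJ _ hm.1
  obtain ⟨ε₂, hε₂, h₂⟩ := Metric.isOpen_iff.1 hJ _ hm.2
  have ha : min 0 s - ε₁ / 2 ∈ J := h₁ (by
    rw [Metric.mem_ball, Real.dist_eq, sub_sub_cancel_left, abs_neg, abs_of_pos] <;> linarith)
  have hb : max 0 s + ε₂ / 2 ∈ J := h₂ (by
    rw [Metric.mem_ball, Real.dist_eq, add_sub_cancel_left, abs_of_pos] <;> linarith)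
  have hsub : Ioo (min 0 s - ε₁ / 2) (max 0 s + ε₂ / 2) ⊆ J :=
    Ioo_subset_Icc_self.trans (hJc.out ha hb)
  refine ⟨fun t ↦ e.symm (y + t • v₀), min 0 s - ε₁ / 2, max 0 s + ε₂ / 2,
    ⟨?_, ?_⟩, fun t ht ↦ ?_, by simp, s, ⟨?_, ?_⟩, rfl⟩
  · linarith [min_le_left 0 s]
  · linarith [le_max_left 0 s]
  · exact (h.hasMFDerivAt_line (hsub ht)).hasMFDerivWithinAt
  · linarith [min_le_right 0 s]
  · linarith [le_max_right 0 s]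

variable [IsManifold (𝓡 n) ∞ M] (g : PseudoRiemannianMetric n M)

/-- In a flow box the equation `∇ v = (c/2) id` reads `Γ(u, v₀) = (c/2) u`. -/
lemma christoffelSymbols_eq
    (hv : ContMDiff (𝓡 n) (𝓡 n).tangent ∞ (fun x ↦ (⟨x, v x⟩ : TangentBundle (𝓡 n) M)))
    {c : ℝ} (hc : ∀ x₀ : M, ∀ y ∈ (extChartAt (𝓡 n) x₀).target, ∀ u : Model n,
      g.covDerivInChart v x₀ y u = (c / 2) • u) {y : Model n} (hy : y ∈ e.target) (u : Model n) :
    christoffelSymbols (metricIn g e) y u v₀ = (c / 2) • u := by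
  have h1 := covDeriv_fieldIn g hv hc h.chart hy u
  have h2 : fieldIn v e =ᶠ[𝓝 y] fun _ ↦ v₀ := by
    filter_upwards [e.open_target.mem_nhds hy] with z hz using h.straight _ (e.map_target hz)
  rw [h2.fderiv_eq, h2.self_of_nhds] at h1
  simpa using h1

end IsFlowBox

/-! ### Transport along the flow -/

variable [IsManifold (𝓡 n) ∞ M] (g : PseudoRiemannianMetric n M)
  (v : M → Model n)

/-- The differential of a map from the manifold to itself, with the tangent spaces identified with
the model space. -/
def selfDiff (r : M → M) (p : M) : Model n →L[ℝ] Model n := mfderiv (𝓡 n) (𝓡 n) r p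

/-- A smooth map `r` that moves the points of an open set `U` along the flow of `v`, together with
isometries `T p` from the tangent space at `p` to that at `r p` that take parallel fields to
parallel fields. If `r` is the flow for the time `s(p)`, then `T` is parallel transport along the
flow lines, which is `e^{-cs/2} (dr - ds ⊗ v)`. The tangent spaces are identified with the model
space, as they are by definition in Mathlib. -/
structure IsFlowTransport (U : Set M) (r : M → M) (T : M → Model n →L[ℝ] Model n) : Prop where
  isOpen : IsOpen U
  smooth : ContMDiffOn (𝓡 n) (𝓡 n) ∞ r U
  trace : ∀ p ∈ U, r p ∈ integralCurveTrace v p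
  isometry : ∀ p ∈ U, ∀ u w : Model n, g.val (r p) (T p u) (T p w) = g.val p u w
  form : ∀ p ∈ U, ∃ μ : ℝ, 0 < μ ∧ ∃ θ : Model n →L[ℝ] ℝ,
    (∀ u : Model n, T p u = μ • (selfDiff r p u - θ u • v (r p))) ∧ T p (v p) = μ • v (r p)
  parallel : ∀ (γ : ℝ → M) (W : ℝ → TangentBundle (𝓡 n) M) (t : ℝ), t ∈ Icc (0 : ℝ) 1 → γ t ∈ U →
    MDifferentiableWithinAt 𝓘(ℝ, ℝ) (𝓡 n) γ (Icc 0 1) t →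
    (∀ s ∈ Icc (0 : ℝ) 1, (W s).proj = γ s) → IsParallelAt g γ W t →
    IsParallelAt g (r ∘ γ) (fun s ↦ ⟨r (W s).proj, T (W s).proj (W s).snd⟩) t

variable {g v}

lemma mem_integralCurveTrace_trans [T2Space M]
    (hv : ContMDiff (𝓡 n) (𝓡 n).tangent ∞ (fun x ↦ (⟨x, v x⟩ : TangentBundle (𝓡 n) M)))
    {p x z : M} (hx : x ∈ integralCurveTrace v p) (hz : z ∈ integralCurveTrace v x) :
    z ∈ integralCurveTrace v p := by
  have : IsManifold (𝓡 n) 1 M := IsManifold.of_le (n := ∞) (by simp)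
  obtain ⟨γ₁, a₁, b₁, h₁, hγ₁, hγ₁0, s₁, hs₁, rfl⟩ := hx
  obtain ⟨γ₂, a₂, b₂, h₂, hγ₂, hγ₂0, s₂, hs₂, rfl⟩ := hz
  have hγ₂' : IsMIntegralCurveOn (I := 𝓡 n) (fun t ↦ γ₂ (t - s₁)) v (Ioo (a₂ + s₁) (b₂ + s₁)) := by
    have := hγ₂.comp_add (-s₁)
    convert! this using 1
    ext t
    simp only [mem_Ioo, mem_ofPred_eq]
    constructor <;> rintro ⟨h, h'⟩ <;> constructor <;> linarith
  have hmem : s₁ ∈ Ioo a₁ b₁ ∩ Ioo (a₂ + s₁) (b₂ + s₁) :=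
    ⟨hs₁, by linarith [h₂.1], by linarith [h₂.2]⟩
  have heq : γ₁ s₁ = (fun t ↦ γ₂ (t - s₁)) s₁ := by simp [hγ₂0]
  have hpw := isMIntegralCurveOn_piecewise (hv.of_le (by simp)) hγ₁ hγ₂' hmem heq
  rw [Ioo_union_Ioo' (hmem.2.1.trans hmem.1.2) (hmem.1.1.trans hmem.2.2)] at hpw
  have hs₂' : s₂ + s₁ ∈ Ioo (a₂ + s₁) (b₂ + s₁) := ⟨by linarith [hs₂.1], by linarith [hs₂.2]⟩
  refine ⟨_, _, _, ⟨?_, ?_⟩, hpw, ?_, s₂ + s₁, ⟨?_, ?_⟩, ?_⟩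
  · exact (min_le_left _ _).trans_lt h₁.1
  · exact h₁.2.trans_le (le_max_left _ _)
  · rw [piecewise_eq_of_mem _ _ _ h₁, hγ₁0]
  · exact (min_le_right _ _).trans_lt hs₂'.1
  · exact hs₂'.2.trans_le (le_max_right _ _)
  · have := eqOn_piecewise_of_isMIntegralCurveOn_Ioo (hv.of_le (by simp)) hγ₁ hγ₂' hmem heq hs₂'
    simpa using this

namespace IsFlowTransport

variable {U U' : Set M} {r r' : M → M} {T T' : M → Model n →L[ℝ] Model n}

lemma mono (h : IsFlowTransport g v U r T) (hU' : IsOpen U') (hsub : U' ⊆ U) :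
    IsFlowTransport g v U' r T :=
  ⟨hU', h.smooth.mono hsub, fun p hp ↦ h.trace p (hsub hp), fun p hp ↦ h.isometry p (hsub hp),
    fun p hp ↦ h.form p (hsub hp), fun γ W t ht hγt ↦ h.parallel γ W t ht (hsub hγt)⟩

lemma comp [T2Space M]
    (hv : ContMDiff (𝓡 n) (𝓡 n).tangent ∞ (fun x ↦ (⟨x, v x⟩ : TangentBundle (𝓡 n) M)))
    (h : IsFlowTransport g v U r T) (h' : IsFlowTransport g v U' r' T') :
    IsFlowTransport g v (U ∩ r ⁻¹' U') (r' ∘ r) (fun p ↦ T' (r p) ∘L T p) where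
  isOpen := h.smooth.continuousOn.isOpen_inter_preimage h.isOpen h'.isOpen
  smooth := h'.smooth.comp (h.smooth.mono inter_subset_left) fun p hp ↦ hp.2
  trace p hp := mem_integralCurveTrace_trans hv (h.trace p hp.1) (h'.trace _ hp.2)
  isometry p hp u w :=
    (h'.isometry _ hp.2 (T p u) (T p w)).trans (h.isometry p hp.1 u w)
  form p hp := by
    obtain ⟨μ, hμ, θ, h1, h2⟩ := h.form p hp.1
    obtain ⟨μ', hμ', θ', h1', h2'⟩ := h'.form _ hp.2
    have hd : HasMFDerivAt (𝓡 n) (𝓡 n) r p (mfderiv (𝓡 n) (𝓡 n) r p) :=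
      ((h.smooth.contMDiffAt (h.isOpen.mem_nhds hp.1)).mdifferentiableAt (by simp)).hasMFDerivAt
    have hd' : HasMFDerivAt (𝓡 n) (𝓡 n) r' (r p) (mfderiv (𝓡 n) (𝓡 n) r' (r p)) :=
      ((h'.smooth.contMDiffAt (h'.isOpen.mem_nhds hp.2)).mdifferentiableAt (by simp)).hasMFDerivAt
    have hcomp := (hd'.comp p hd).mfderiv
    have hcomp' : ∀ u : Model n, selfDiff (r' ∘ r) p u = selfDiff r' (r p) (selfDiff r p u) :=
      fun u ↦ congrArg (fun L : Model n →L[ℝ] Model n ↦ L u) hcomp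
    refine ⟨μ' * μ, by positivity, θ + θ' ∘L selfDiff r p, fun u ↦ ?_, ?_⟩
    · have e1 : T' (r p) (T p u) = μ • (T' (r p) (selfDiff r p u) - θ u • T' (r p) (v (r p))) := by
        rw [h1, map_smul, map_sub, map_smul]
      change T' (r p) (T p u) = (μ' * μ) • (selfDiff (r' ∘ r) p u -
        (θ u + θ' (selfDiff r p u)) • v (r' (r p)))
      rw [hcomp', e1, h2', h1']
      module
    · change T' (r p) (T p (v p)) = (μ' * μ) • v (r' (r p))
      rw [h2, map_smul, h2', smul_smul, mul_comm]
  parallel γ W t ht hγt hγ hW hpar := by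
    have hd : MDifferentiableAt (𝓡 n) (𝓡 n) r (γ t) :=
      (h.smooth.contMDiffAt (h.isOpen.mem_nhds hγt.1)).mdifferentiableAt (by simp)
    exact h'.parallel (r ∘ γ) _ t ht hγt.2 (hd.comp_mdifferentiableWithinAt t hγ)
      (fun s hs ↦ by simp [hW s hs]) (h.parallel γ W t ht hγt.1 hγ hW hpar)

end IsFlowTransport

lemma apply_smul_smul (b : Model n →L[ℝ] Model n →L[ℝ] ℝ) (k : ℝ) (u w : Model n) :
    b (k • u) (k • w) = k * (k * b u w) := by
  simp

/-- In a flow box, a smooth shift along the flow is covered by a transport. -/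
theorem IsFlowBox.isFlowTransport_shift
    (hv : ContMDiff (𝓡 n) (𝓡 n).tangent ∞ (fun x ↦ (⟨x, v x⟩ : TangentBundle (𝓡 n) M)))
    {c : ℝ} (hc : ∀ x₀ : M, ∀ y ∈ (extChartAt (𝓡 n) x₀).target, ∀ u : Model n,
      g.covDerivInChart v x₀ y u = (c / 2) • u)
    {v₀ : Model n} {e : OpenPartialHomeomorph M (Model n)} (h : IsFlowBox v v₀ e)
    {O : Set (Model n)} (hO : IsOpen O) (hOe : O ⊆ e.target) {σ : Model n → ℝ}
    (hσ : ContDiffOn ℝ ∞ σ O) (hσO : ∀ y ∈ O, y + σ y • v₀ ∈ e.target) :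
    IsFlowTransport g v (e.source ∩ e ⁻¹' O) (fun p ↦ e.symm (e p + σ (e p) • v₀))
      (fun p ↦ Real.exp (-(c / 2) * σ (e p)) •
        (coordDiffSymm e (e p + σ (e p) • v₀) ∘L coordDiff e p)) := by
  have he := h.chart
  have hinv : ∀ y ∈ e.target, (metricIn g e y).IsInvertible := fun y hy ↦
    isInvertible_metricIn g he hy
  have hdiff : ∀ y ∈ e.target, DifferentiableAt ℝ (metricIn g e) y := fun y hy ↦
    differentiableAt_metricIn g he hy
  have hsymm : ∀ y ∈ e.target, ∀ u w, metricIn g e y u w = metricIn g e y w u := fun y _ ↦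
    metricIn_symm g e y
  have hΓ : ∀ y ∈ e.target, ∀ u, christoffelSymbols (metricIn g e) y u v₀ = (c / 2) • u :=
    fun y hy ↦ h.christoffelSymbols_eq g hv hc hy
  set ψ : Model n → Model n := fun y ↦ y + σ y • v₀
  set r : M → M := fun p ↦ e.symm (e p + σ (e p) • v₀)
  set T : M → Model n →L[ℝ] Model n := fun p ↦ Real.exp (-(c / 2) * σ (e p)) •
        (coordDiffSymm e (e p + σ (e p) • v₀) ∘L coordDiff e p)
  have hψ : ContDiffOn ℝ ∞ ψ O := contDiffOn_id.add (hσ.smul contDiffOn_const)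
  have hσd : ∀ y ∈ O, DifferentiableAt ℝ σ y := fun y hy ↦
    (hσ.contDiffAt (hO.mem_nhds hy)).differentiableAt (by simp)
  have hopen : IsOpen (e.source ∩ e ⁻¹' O) := e.isOpen_inter_preimage hO
  have hsmooth : ContMDiffOn (𝓡 n) (𝓡 n) ∞ r (e.source ∩ e ⁻¹' O) :=
    he.smooth_symm.comp (hψ.contMDiffOn.comp (he.smooth.mono inter_subset_left) fun p hp ↦ hp.2)
      fun p hp ↦ hσO _ hp.2
  refine ⟨hopen, hsmooth, fun p hp ↦ ?_, fun p hp u w ↦ ?_, fun p hp ↦ ?_, ?_⟩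
  · have := h.mem_integralCurveTrace (e.map_source hp.1) (hσO _ hp.2)
    rwa [e.left_inv hp.1] at this
  · have h1 := apply_add_smul e.open_target h.convex hinv hdiff hsymm hΓ (e.map_source hp.1)
      (hσO _ hp.2)
    have h2 := congrArg (fun L ↦ L (coordDiff e p u) (coordDiff e p w)) h1
    simp only [smul_apply, smul_eq_mul] at h2
    rw [metricIn_apply, metricIn_apply, he.coordDiffSymm_coordDiff hp.1,
      he.coordDiffSymm_coordDiff hp.1, e.left_inv hp.1] at h2
    have h3 : g.val (r p) (T p u) (T p w) = Real.exp (-(c / 2) * σ (e p)) *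
        (Real.exp (-(c / 2) * σ (e p)) *
          g.val (r p) (coordDiffSymm e (e p + σ (e p) • v₀) (coordDiff e p u))
            (coordDiffSymm e (e p + σ (e p) • v₀) (coordDiff e p w))) := by
      exact apply_smul_smul (g.val (r p)) _ _ _
    rw [h3, h2, ← mul_assoc, ← mul_assoc, ← Real.exp_add, ← Real.exp_add]
    ring_nf
    simp
  · have hz := hσO _ hp.2
    have hv₀ : coordDiffSymm e (e p + σ (e p) • v₀) v₀ = v (r p) := h.coordDiffSymm_eq hz
    have hdψ : HasFDerivAt ψ (ContinuousLinearMap.id ℝ _ + (fderiv ℝ σ (e p)).smulRight v₀) (e p) :=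
      (hasFDerivAt_id _).add ((hσd _ hp.2).hasFDerivAt.smul_const v₀)
    have hd := (((he.hasMFDerivAt_symm hz).comp p
      ((hdψ.hasMFDerivAt).comp p (he.hasMFDerivAt hp.1)))).mfderiv
    have hd' : ∀ u : Model n, selfDiff r p u =
        coordDiffSymm e (e p + σ (e p) • v₀)
          (coordDiff e p u + fderiv ℝ σ (e p) (coordDiff e p u) • v₀) := fun u ↦
      congrArg (fun L : Model n →L[ℝ] Model n ↦ L u) hd
    refine ⟨Real.exp (-(c / 2) * σ (e p)), Real.exp_pos _, fderiv ℝ σ (e p) ∘L coordDiff e p,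
      fun u ↦ ?_, ?_⟩
    · rw [hd', map_add, map_smul, hv₀]
      simp only [T, smul_apply, ContinuousLinearMap.comp_apply]
      rw [add_sub_cancel_right]
    · simp only [T, smul_apply, ContinuousLinearMap.comp_apply]
      rw [h.straight p hp.1, hv₀]
  · intro γ W t ht hγt hγ hW hpar
    have hd : MDifferentiableAt (𝓡 n) (𝓡 n) r (γ t) :=
      (hsmooth.contMDiffAt (hopen.mem_nhds hγt)).mdifferentiableAt (by simp)
    have hz := hσO _ hγt.2
    have hrs : ∀ p ∈ e.source ∩ e ⁻¹' O, r p ∈ e.source := fun p hp ↦ e.map_target (hσO _ hp.2)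
    rw [isParallelAt_iff g he ht (hd.comp_mdifferentiableWithinAt t hγ)
      (fun s hs ↦ by simp [hW s hs]) (hrs _ hγt)]
    rw [isParallelAt_iff g he ht hγ hW hγt.1] at hpar
    have hx := (he.differentiableWithinAt_comp hγ hγt.1).hasDerivWithinAt
    set B : Model n → Model n →L[ℝ] Model n := fun z ↦
      Real.exp (-(c / 2) * σ z) • ContinuousLinearMap.id ℝ (Model n)
    have hB : DifferentiableAt ℝ B ((e ∘ γ) t) :=
      ((hσd _ hγt.2).const_mul (-(c / 2))).exp.smul_const _
    have key := hasDerivWithinAt_parallel (ψ := ψ) (x := e ∘ γ) hB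
      (shift_intertwines e.open_target h.convex hinv hdiff hsymm hΓ (hOe hγt.2) (hσd _ hγt.2) hz)
      hx hpar
    have hev : ∀ᶠ s in 𝓝[Icc 0 1] t, γ s ∈ e.source ∩ e ⁻¹' O :=
      hγ.continuousWithinAt.preimage_mem_nhdsWithin (hopen.mem_nhds hγt)
    have her : ∀ p ∈ e.source ∩ e ⁻¹' O, e (r p) = ψ (e p) := fun p hp ↦
      e.right_inv (hσO _ hp.2)
    have hderiv : derivWithin (e ∘ r ∘ γ) (Icc 0 1) t =
        fderiv ℝ ψ (e (γ t)) (derivWithin (e ∘ γ) (Icc 0 1) t) := by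
      have h1 : HasDerivWithinAt (ψ ∘ (e ∘ γ))
          (fderiv ℝ ψ (e (γ t)) (derivWithin (e ∘ γ) (Icc 0 1) t)) (Icc 0 1) t :=
        ((hψ.contDiffAt (hO.mem_nhds hγt.2)).differentiableAt
          (by simp)).hasFDerivAt.comp_hasDerivWithinAt t hx
      refine (h1.congr_of_eventuallyEq ?_ (her _ hγt)).derivWithin
        (uniqueDiffOn_Icc zero_lt_one t ht)
      filter_upwards [hev] with s hs using her _ hs
    have hval : ∀ s ∈ Icc (0 : ℝ) 1, γ s ∈ e.source ∩ e ⁻¹' O →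
        coordDiff e (r (W s).proj) (T (W s).proj (W s).snd) =
          B ((e ∘ γ) s) (coordDiff e (W s).proj (W s).snd) := by
      intro s hs hs2
      have key : ∀ u : Model n, coordDiff e (r (γ s)) (T (γ s) u) =
          B ((e ∘ γ) s) (coordDiff e (γ s) u) := fun u ↦ by
        simp only [T, r, B, smul_apply, ContinuousLinearMap.comp_apply,
          ContinuousLinearMap.id_apply, map_smul, Function.comp_apply]
        rw [he.coordDiff_coordDiffSymm (hσO _ hs2.2)]
      rw [hW s hs]
      exact key _
    unfold IsParallelInChart
    rw [hderiv, hval t ht hγt, show e ((r ∘ γ) t) = ψ ((e ∘ γ) t) from her _ hγt]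
    refine key.congr_of_eventuallyEq ?_ (hval t ht hγt)
    filter_upwards [hev, self_mem_nhdsWithin] with s hs hsI using hval s hsI hs

end FlowTransport

/-! ### Uniqueness of the isometry -/

/-- Linear algebra behind the uniqueness of the transport: two isometries that both have the form
`u ↦ μ (D u - θ(u) w)` with `μ > 0`, and that take the same vector `a` to a positive multiple of
`w`, are equal. Both causal types of `a`, null and non-null, have to be considered. -/
lemma eq_of_isometry_form {V : Type*} [NormedAddCommGroup V] [NormedSpace ℝ V]
    {B b : V →L[ℝ] V →L[ℝ] ℝ} (hB : ∀ u z, B u z = B z u) {a w : V} (hw : w ≠ 0)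
    (ha : ∃ z, B a z ≠ 0) {D T T' : V →L[ℝ] V} {μ μ' : ℝ} (hμ : 0 < μ) (hμ' : 0 < μ')
    {θ θ' : V →L[ℝ] ℝ} (hT : ∀ u, T u = μ • (D u - θ u • w))
    (hT' : ∀ u, T' u = μ' • (D u - θ' u • w)) (hTa : T a = μ • w) (hTa' : T' a = μ' • w)
    (hiso : ∀ u z, b (T u) (T z) = B u z) (hiso' : ∀ u z, b (T' u) (T' z) = B u z) : T = T' := by
  -- `k = μ' / μ` and `α = θ - θ'` measure the difference between `T` and `T'`.
  obtain ⟨k, hk, rfl⟩ : ∃ k : ℝ, 0 < k ∧ k * μ = μ' := ⟨μ' / μ, by positivity, by field_simp⟩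
  set α : V →L[ℝ] ℝ := θ - θ'
  have hα : ∀ u, α u = θ u - θ' u := fun u ↦ rfl
  have key : ∀ u, T' u = k • (T u + α u • T a) := fun u ↦ by
    rw [hT', hTa, hT, hα]
    module
  have hαa : α a = 0 := by
    have h1 := key a
    rw [hTa', hTa] at h1
    have h2 : (k * μ * α a) • w = 0 := by
      have : (k * μ * α a) • w = k • (μ • w + α a • μ • w) - (k * μ) • w := by module
      rw [this, ← h1, sub_self]
    have h3 := (smul_eq_zero.1 h2).resolve_right hw
    exact (mul_eq_zero.1 h3).resolve_left (by positivity)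
  have hrel : ∀ u z, B u z = k * k * (B u z + α z * B u a + α u * B a z + α u * α z * B a a) :=
    fun u z ↦ by
      have h1 := hiso' u z
      rw [key, key] at h1
      simp only [map_smul, map_add, smul_apply, add_apply, smul_eq_mul, hiso] at h1
      linarith
  have hrel₁ : ∀ u, B u a = k * k * (B u a + α u * B a a) := fun u ↦ by
    have := hrel u a
    rw [hαa] at this
    linarith
  obtain ⟨z₀, hz₀⟩ := ha
  have hk1 : k * k = 1 → k = 1 := fun h ↦ by nlinarith
  have main : k = 1 ∧ ∀ u, α u = 0 := by
    by_cases haa : B a a = 0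
    · have hk : k = 1 := by
        have h1 := hrel₁ z₀
        rw [haa, mul_zero, add_zero, hB z₀ a] at h1
        exact hk1 (mul_right_cancel₀ hz₀ (by linarith))
      refine ⟨hk, fun u ↦ ?_⟩
      have h1 := hrel u u
      have h2 := hrel u z₀
      rw [hk, haa, hB u a] at h1 h2
      have h3 : α u * B a u = 0 := by linarith
      rcases mul_eq_zero.1 h3 with h | h
      · exact h
      · rw [h] at h2
        exact (mul_eq_zero.1 (by linarith : α u * B a z₀ = 0)).resolve_right hz₀
    · have hk : k = 1 := by
        have h1 := hrel₁ a
        rw [hαa, zero_mul, add_zero] at h1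
        exact hk1 (mul_right_cancel₀ haa (by linarith))
      refine ⟨hk, fun u ↦ ?_⟩
      have h1 := hrel₁ u
      rw [hk] at h1
      exact (mul_eq_zero.1 (by linarith : α u * B a a = 0)).resolve_right haa
  ext1 u
  rw [key, main.1, main.2, zero_smul, add_zero, one_smul]

/-! ### Transport to the hypersurface -/

section Projection

variable {n : ℕ} {M : Type*} [TopologicalSpace M] [ChartedSpace (EuclideanSpace ℝ (Fin n)) M]
  [IsManifold (𝓡 n) ∞ M] {g : PseudoRiemannianMetric n M} {v : M → Model n} {E : Set M} {c : ℝ}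

/-- Two transports into a transverse hypersurface agree wherever both are defined. Their maps agree
since an integral curve meets the hypersurface only once; that the isometries agree needs an
argument, because a closed integral curve can be followed a different number of times. -/
theorem IsFlowTransport.unique (hne : ∀ x, v x ≠ 0) (hEv : IsTransverseTo E v) {U U' : Set M}
    {r r' : M → M} {T T' : M → Model n →L[ℝ] Model n} (h : IsFlowTransport g v U r T)
    (h' : IsFlowTransport g v U' r' T') (hr : ∀ z ∈ U, r z ∈ E) (hr' : ∀ z ∈ U', r' z ∈ E) {p : M}
    (hp : p ∈ U) (hp' : p ∈ U') : r p = r' p ∧ T p = T' p := by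
  have heq : ∀ z ∈ U ∩ U', r z = r' z := fun z hz ↦
    (hEv.meets_once z).unique ⟨hr z hz.1, h.trace z hz.1⟩ ⟨hr' z hz.2, h'.trace z hz.2⟩
  have hrp := heq p ⟨hp, hp'⟩
  have hD : selfDiff (n := n) r p = selfDiff r' p := by
    have : r =ᶠ[𝓝 p] r' :=
      Filter.eventuallyEq_of_mem ((h.isOpen.inter h'.isOpen).mem_nhds ⟨hp, hp'⟩) heq
    exact this.mfderiv_eq
  obtain ⟨μ, hμ, θ, h1, h2⟩ := h.form p hp
  obtain ⟨μ', hμ', θ', h1', h2'⟩ := h'.form p hp'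
  have hiso' := h'.isometry p hp'
  rw [← hD, ← hrp] at h1'
  rw [← hrp] at h2' hiso'
  refine ⟨hrp, eq_of_isometry_form (B := g.val p) (b := g.val (r p)) (g.symm p) (hne (r p)) ?_
    hμ hμ' h1 h1' h2 h2' (h.isometry p hp) hiso'⟩
  by_contra! hz
  exact hne p (g.nondegenerate p (v p) hz)

variable (hv : ContMDiff (𝓡 n) (𝓡 n).tangent ∞ (fun x ↦ (⟨x, v x⟩ : TangentBundle (𝓡 n) M)))
  (hne : ∀ x, v x ≠ 0)
  (hc : ∀ x₀ : M, ∀ y ∈ (extChartAt (𝓡 n) x₀).target, ∀ u : Model n,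
    g.covDerivInChart v x₀ y u = (c / 2) • u)

variable (g v) in
/-- The point `p` can be moved to `x` by a transport along the flow defined near `p`. -/
def FlowConnected (p x : M) : Prop :=
  ∃ (U : Set M) (r : M → M) (T : M → Model n →L[ℝ] Model n),
    IsFlowTransport g v U r T ∧ p ∈ U ∧ r p = x

include hv in
lemma FlowConnected.trans [T2Space M] {p x z : M} (h : FlowConnected g v p x)
    (h' : FlowConnected g v x z) : FlowConnected g v p z := by
  obtain ⟨U, r, T, h, hp, rfl⟩ := h
  obtain ⟨U', r', T', h', hp', rfl⟩ := h'
  exact ⟨_, _, _, h.comp hv h', ⟨hp, hp'⟩, rfl⟩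

include hv hc in
lemma IsFlowBox.flowConnected {v₀ : Model n} {e : OpenPartialHomeomorph M (Model n)}
    (h : IsFlowBox v v₀ e) {y : Model n} {s t : ℝ} (hs : y + s • v₀ ∈ e.target)
    (ht : y + t • v₀ ∈ e.target) :
    FlowConnected g v (e.symm (y + s • v₀)) (e.symm (y + t • v₀)) := by
  have hO : IsOpen (e.target ∩ (fun y ↦ y + (t - s) • v₀) ⁻¹' e.target) :=
    e.open_target.inter (e.open_target.preimage (by fun_prop))
  have hst : y + s • v₀ + (t - s) • v₀ = y + t • v₀ := by module
  refine ⟨_, _, _, h.isFlowTransport_shift hv hc hO inter_subset_left (σ := fun _ ↦ t - s)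
    contDiffOn_const fun y hy ↦ hy.2, ⟨e.map_target hs, ?_⟩, ?_⟩
  · rw [mem_preimage, e.right_inv hs]
    refine ⟨hs, ?_⟩
    rwa [mem_preimage, hst]
  · rw [e.right_inv hs, hst]

include hv hne hc in
/-- A point can be moved to every other point of its integral curve. -/
theorem flowConnected_of_mem_integralCurveTrace [T2Space M] {p x : M}
    (hx : x ∈ integralCurveTrace v p) : FlowConnected g v p x := by
  have : IsManifold (𝓡 n) 1 M := IsManifold.of_le (n := ∞) (by simp)
  obtain ⟨η, a, b, h0, hη, rfl, s, hs, rfl⟩ := hx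
  refine isPreconnected_Ioo.induction₂' (fun τ τ' ↦ FlowConnected g v (η τ) (η τ')) ?_
    (fun _ _ _ _ _ _ h h' ↦ h.trans hv h') h0 hs
  intro τ₀ hτ₀
  obtain ⟨v₀, e, he, hes⟩ := exists_flowBox hv (hne (η τ₀))
  set y : Model n := e (η τ₀) - τ₀ • v₀
  have hy : y + τ₀ • v₀ = e (η τ₀) := sub_add_cancel _ _
  have hJ : IsOpen ((fun τ : ℝ ↦ y + τ • v₀) ⁻¹' e.target) :=
    e.open_target.preimage (by fun_prop)
  have hJτ₀ : y + τ₀ • v₀ ∈ e.target := hy ▸ e.map_source hes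
  have hline : IsMIntegralCurveAt (I := 𝓡 n) (fun τ : ℝ ↦ e.symm (y + τ • v₀)) v τ₀ := by
    filter_upwards [hJ.mem_nhds hJτ₀] with τ hτ using he.hasMFDerivAt_line hτ
  have heq : η =ᶠ[𝓝 τ₀] fun τ : ℝ ↦ e.symm (y + τ • v₀) :=
    isMIntegralCurveAt_eventuallyEq_of_contMDiffAt_boundaryless
      ((hv.of_le (by simp)).contMDiffAt) (hη.isMIntegralCurveAt (Ioo_mem_nhds hτ₀.1 hτ₀.2)) hline
      (by rw [hy, e.left_inv hes])
  filter_upwards [nhdsWithin_le_nhds heq, nhdsWithin_le_nhds (hJ.mem_nhds hJτ₀)] with τ hτ hτJ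
  rw [hτ, heq.self_of_nhds]
  exact ⟨he.flowConnected hv hc hJτ₀ hτJ, he.flowConnected hv hc hτJ hJτ₀⟩

include hv hne hc in
/-- Near a point of a transverse hypersurface there is a transport into the hypersurface that is
the identity at that point. -/
theorem exists_transport_near_hypersurface (hE : IsHypersurface n E) (hEv : IsTransverseTo E v)
    {x : M} (hx : x ∈ E) :
    ∃ (U : Set M) (r : M → M) (T : M → Model n →L[ℝ] Model n), IsFlowTransport g v U r T ∧
      x ∈ U ∧ (∀ z ∈ U, r z ∈ E) ∧ r x = x ∧ ∀ u, T x u = u := by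
  obtain ⟨U₀, f, hf⟩ := hE x hx
  obtain ⟨v₀, e, he, hes⟩ := exists_flowBox hv (hne x)
  set O : Set (Model n) := e.target ∩ e.symm ⁻¹' U₀
  have hO : IsOpen O := e.isOpen_inter_preimage_symm hf.isOpen
  have hh : ContDiffOn ℝ ∞ (f ∘ e.symm) O := contMDiffOn_iff_contDiffOn.1
    (hf.smooth.comp (he.chart.smooth_symm.mono inter_subset_left) fun y hy ↦ hy.2)
  have hxO : e x ∈ O := ⟨e.map_source hes, by rw [mem_preimage, e.left_inv hes]; exact hf.mem⟩
  have h0 : (f ∘ e.symm) (e x) = 0 := by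
    rw [Function.comp_apply, e.left_inv hes]
    exact (hf.eq_zero_iff x hf.mem).1 hx
  have hder : ∀ z, z = e.symm (e x) → z ∈ U₀ →
      fderiv ℝ (f ∘ e.symm) (e x) v₀ = mfderiv (𝓡 n) 𝓘(ℝ, ℝ) f z (v z) := by
    rintro z rfl hz
    have hfd := ((hf.smooth.contMDiffAt (hf.isOpen.mem_nhds hz)).mdifferentiableAt
      (by simp)).hasMFDerivAt
    let D : Model n →L[ℝ] ℝ := mfderiv (𝓡 n) 𝓘(ℝ, ℝ) f (e.symm (e x))
    have h1 : HasFDerivAt (f ∘ e.symm) (D ∘L coordDiffSymm e (e x)) (e x) :=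
      (hfd.comp (e x) (he.chart.hasMFDerivAt_symm (e.map_source hes))).hasFDerivAt
    have h2 : fderiv ℝ (f ∘ e.symm) (e x) v₀ = D (v (e.symm (e x))) := by
      rw [h1.fderiv, ContinuousLinearMap.comp_apply, he.coordDiffSymm_eq (e.map_source hes)]
    exact h2
  have hv₀ : fderiv ℝ (f ∘ e.symm) (e x) v₀ ≠ 0 := by
    rw [hder x (e.left_inv hes).symm hf.mem]
    exact hEv.not_tangent x hx U₀ f hf
  obtain ⟨O', σ, hO', hxO', hσ, hσ0, hhit⟩ := exists_smooth_hitting_time hO hh hxO h0 hv₀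
  refine ⟨_, _, _, he.isFlowTransport_shift hv hc (hO'.inter e.open_target) inter_subset_right
    (hσ.mono inter_subset_left) fun y hy ↦ (hhit y hy.1).1.1, ⟨hes, hxO', e.map_source hes⟩,
    fun z hz ↦ ?_, ?_, fun u ↦ ?_⟩
  · have := hhit (e z) hz.2.1
    exact (hf.eq_zero_iff _ this.1.2).2 this.2
  · rw [hσ0, zero_smul, add_zero, e.left_inv hes]
  · simp only [hσ0, zero_smul, add_zero, mul_zero, Real.exp_zero, one_smul,
      ContinuousLinearMap.comp_apply]
    exact he.chart.coordDiffSymm_coordDiff hes u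

include hv hne hc in
/-- Near every point there is a transport into the hypersurface. -/
theorem exists_transport_to_hypersurface [T2Space M] (hE : IsHypersurface n E)
    (hEv : IsTransverseTo E v) (p : M) :
    ∃ (U : Set M) (r : M → M) (T : M → Model n →L[ℝ] Model n), IsFlowTransport g v U r T ∧
      p ∈ U ∧ ∀ z ∈ U, r z ∈ E := by
  obtain ⟨x, ⟨hx, hpx⟩, -⟩ := hEv.meets_once p
  obtain ⟨U, r, T, h, hp, rfl⟩ := flowConnected_of_mem_integralCurveTrace hv hne hc hpx
  obtain ⟨U', r', T', h', hp', hr', -⟩ :=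
    exists_transport_near_hypersurface hv hne hc hE hEv hx
  exact ⟨_, _, _, h.comp hv h', ⟨hp, hp'⟩, fun z hz ↦ hr' _ hz.2⟩

include hv hne hc in
/-- The projection `ρ` onto the hypersurface along the integral curves, together with isometries
`τ p` from the tangent space at `p` to that at `ρ p`: it is locally a transport, and it is the
identity on the hypersurface. -/
theorem exists_projection [T2Space M] (hE : IsHypersurface n E) (hEv : IsTransverseTo E v) :
    ∃ (ρ : M → M) (τ : M → Model n →L[ℝ] Model n), (∀ p, ρ p ∈ E) ∧
      (∀ q ∈ E, ρ q = q ∧ ∀ u, τ q u = u) ∧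
      ∀ p, ∃ (U : Set M) (r : M → M) (T : M → Model n →L[ℝ] Model n),
        IsFlowTransport g v U r T ∧ p ∈ U ∧ ∀ z ∈ U, ρ z = r z ∧ τ z = T z := by
  choose U r T h hp hr using exists_transport_to_hypersurface hv hne hc hE hEv
  refine ⟨fun p ↦ r p p, fun p ↦ T p p, fun p ↦ hr p p (hp p), fun q hq ↦ ?_, fun p ↦
    ⟨U p, r p, T p, h p, hp p, fun z hz ↦ (h z).unique hne hEv (h p) (hr z) (hr p) (hp z) hz⟩⟩
  obtain ⟨U', r', T', h', hq', hr', hrq, hTq⟩ :=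
    exists_transport_near_hypersurface hv hne hc hE hEv hq
  have := (h q).unique hne hEv h' (hr q) hr' (hp q) hq'
  refine ⟨this.1.trans hrq, fun u ↦ ?_⟩
  exact (congrArg (fun L : Model n →L[ℝ] Model n ↦ L u) this.2).trans (hTq u)

include hv hne hc in
/-- Parallel translation around a loop based on the hypersurface is also parallel translation
around the projected loop. -/
theorem exists_loop_in_hypersurface [T2Space M] (hE : IsHypersurface n E)
    (hEv : IsTransverseTo E v) {q : M} (hq : q ∈ E) {γ : ℝ → M} (hγ : IsLoopIn n univ q γ) :
    ∃ γ' : ℝ → M, IsLoopIn n E q γ' ∧ ∀ u w : TangentSpace (𝓡 n) q,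
      g.Transports γ ⟨q, u⟩ ⟨q, w⟩ → g.Transports γ' ⟨q, u⟩ ⟨q, w⟩ := by
  obtain ⟨ρ, τ, hρE, hρq, hloc⟩ := exists_projection hv hne hc hE hEv
  set K : TangentBundle (𝓡 n) M → TangentBundle (𝓡 n) M := fun w ↦ ⟨ρ w.proj, τ w.proj w.snd⟩
  have hfix : ∀ u : TangentSpace (𝓡 n) q, K ⟨q, u⟩ = ⟨q, u⟩ := by
    have : ∀ (x : M) (u u' : Model n), x = q → u = u' →
        (⟨x, u⟩ : TangentBundle (𝓡 n) M) = ⟨q, u'⟩ := by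
      rintro x u u' rfl rfl
      rfl
    exact fun u ↦ this _ _ _ (hρq q hq).1 ((hρq q hq).2 u)
  refine ⟨ρ ∘ γ, ⟨fun t ht ↦ ?_, ?_, ?_, fun t _ ↦ hρE _⟩, ?_⟩
  · obtain ⟨U, r, T, h, hp, hU⟩ := hloc (γ t)
    refine ((h.smooth.contMDiffAt (h.isOpen.mem_nhds hp)).comp_contMDiffWithinAt t
      (hγ.smooth t ht)).congr_of_eventuallyEq ?_ (hU _ hp).1
    filter_upwards [(hγ.smooth t ht).continuousWithinAt.preimage_mem_nhdsWithin
      (h.isOpen.mem_nhds hp)] with s hs using (hU _ hs).1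
  · rw [Function.comp_apply, hγ.source, (hρq q hq).1]
  · rw [Function.comp_apply, hγ.target, (hρq q hq).1]
  rintro u w ⟨W, ⟨hWγ, hW⟩, hW0, hW1⟩
  refine ⟨K ∘ W, ⟨fun t ht ↦ ?_, fun t ht ↦ ?_⟩, ?_, ?_⟩
  · exact congrArg ρ (hWγ t ht)
  · obtain ⟨U, r, T, h, hp, hU⟩ := hloc (γ t)
    have hpar := h.parallel γ W t ht hp ((hγ.smooth t ht).mdifferentiableWithinAt (by simp)) hWγ
      (hW t ht)
    have hev : ∀ᶠ s in 𝓝[Icc 0 1] t, γ s ∈ U :=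
      (hγ.smooth t ht).continuousWithinAt.preimage_mem_nhdsWithin (h.isOpen.mem_nhds hp)
    refine isParallelAt_congr g ?_ ?_ ht hpar
    · filter_upwards [hev] with s hs using (hU _ hs).1
    · filter_upwards [hev, self_mem_nhdsWithin] with s hs hsI
      have hK : ∀ (x x' : M) (L L' : Model n →L[ℝ] Model n) (u : Model n), x = x' → L = L' →
          (⟨x, L u⟩ : TangentBundle (𝓡 n) M) = ⟨x', L' u⟩ := by
        rintro x x' L L' u rfl rfl
        rfl
      have hsU : (W s).proj ∈ U := by rwa [hWγ s hsI]
      exact hK _ _ _ _ _ (hU _ hsU).1 (hU _ hsU).2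
  · exact (congrArg K hW0).trans (hfix u)
  · exact (congrArg K hW1).trans (hfix w)

end Projection

end HomotheticHolonomy

end

open HomotheticHolonomy in
theorem theorem6p1 {n : ℕ} {M : Type*} [TopologicalSpace M] [T2Space M]
    [ChartedSpace (EuclideanSpace ℝ (Fin n)) M] [IsManifold (𝓡 n) ∞ M]
    (g : PseudoRiemannianMetric n M)
    (v : ∀ x : M, TangentSpace (𝓡 n) x)
    (hv_smooth : ContMDiff (𝓡 n) (𝓡 n).tangent ∞ (fun x ↦ (⟨x, v x⟩ : TangentBundle (𝓡 n) M)))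
    (hv_ne : ∀ x, v x ≠ 0)
    (hv : g.IsHomotheticGradient v)
    (E : Set M) (hE : IsHypersurface n E) (hEv : IsTransverseTo E v)
    (q : M) (hq : q ∈ E) :
    g.holonomy q = g.holonomyOfLoopsIn E q := by
  obtain ⟨c, hc⟩ := hv
  refine Subset.antisymm ?_ ?_
  · rintro A ⟨hA, hF⟩
    refine ⟨hA, fun F ↦ ?_⟩
    obtain ⟨γ, hγ, hT⟩ := hF F
    obtain ⟨γ', hγ', h⟩ := exists_loop_in_hypersurface hv_smooth hv_ne hc hE hEv hq hγ
    exact ⟨γ', hγ', fun i ↦ h _ _ (hT i)⟩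
  · rintro A ⟨hA, hF⟩
    refine ⟨hA, fun F ↦ ?_⟩
    obtain ⟨γ, hγ, hT⟩ := hF F
    exact ⟨γ, ⟨hγ.smooth, hγ.source, hγ.target, mapsTo_univ _ _⟩, hT⟩
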